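/- Let $g_{\mathrm{can}}$ be the Fubini--Study metric on $\mathbb{CP}^2$, normalized so that the Hopf map $S^5\to\mathbb{CP}^2$ is a Riemannian submersion (so the sectional curvatures lie between $1$ and $4$), and let $J$ be the complex structure. For a Riemannian manifold $(M,g)$ of dimension $n\ge 4$ and $p\in M$, the Weyl operator $W_p:\Lambda^2T_pM\to\Lambda^2T_pM$ is determined by $\langle W_p(x\wedge y),z\wedge t\rangle=W_p(x,y,z,t)$, where $W=R-S\odot g$ is the $(0,4)$ Weyl tensor, $S=\frac1{n-2}\bigl(\mathrm{Ric}-\frac{s}{2(n-1)}g\bigr)$ is the Schouten tensor, $(\alpha\odot\beta)_{ijkl}=\alpha_{ik}\beta_{jl}+\beta_{ik}\alpha_{jl}-\alpha_{il}\beta_{jk}-\alpha_{jk}\beta_{il}$ is the Kulkarni--Nomizu product, $s$ is the scalar curvature, and the sign of $R$ is such that $R(x,y,x,y)$ is the sectional curvature of the plane spanned by an orthonormal pair $x,y$. The operator $W_p$ satisfies the eigenflag condition if there is a nonzero $v\in T_pM$ with $W_p(v\wedge v^\perp)\subset v\wedge v^\perp$. A limiting Carleman weight on an open set $U\subset M$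 is a function $\varphi\in C^\infty(U,\mathbb{R})$ with $d\varphi\neq0$ everywhere on $U$ and such that, on $T^*U$, the Poisson bracket $\{\overline{p_\varphi},p_\varphi\}$ vanishes wherever $p_\varphi=0$, where $p_\varphi(x,\xi)=|\xi|_g^2-|d\varphi|_g^2+2i\langle\xi,d\varphi\rangle_g$. 1. For every $p\in\mathbb{CP}^2$ the space $T_p\mathbb{CP}^2$ has orthonormal bases $(e_1,e_2,e_3,e_4)$ with $e_2=Je_1$ and $e_4=Je_3$. For each such basis, let $\Lambda^\pm$ be the eigenspaces for the eigenvalues $\pm1$ of the Hodge operator on $\Lambda^2T_p\mathbb{CP}^2$ with respect to the orientation $e_1\wedge e_2\wedge e_3\wedge e_4$. Then $\Lambda^2T_p\mathbb{CP}^2=\Lambda^+\oplus\Lambda^-$, the bivectors $\phi_1=e_1\wedge e_2+e_3\wedge e_4$, $\phi_2=e_1\wedge e_3-e_2\wedge e_4$, $\phi_3=e_1\wedge e_4+e_2\wedge e_3$ form a basis of $\Lambda^+$, the Weyl operator $W_p$ of $g_{\mathrm{can}}$ maps $\Lambda^+$ into itself with matrix $W_p^+=\mathrm{diag}(4,-2,-2)$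 in this basis, and $W_p$ vanishes on $\Lambda^-$, that is, $W^-_p=0$. 2. At no point $p\in\mathbb{CP}^2$ does the Weyl operator of $g_{\mathrm{can}}$ satisfy the eigenflag condition. 3. No nonempty open subset of $(\mathbb{CP}^2,g_{\mathrm{can}})$ admits a limiting Carleman weight. 4. More generally, let $(M,g)$ be a smooth Riemannian $4$-manifold in which every point has an open neighbourhood isometric to an open subset of $(\mathbb{CP}^2,g_{\mathrm{can}})$. Then no nonempty open subset of $M$ admits a limiting Carleman weight. -/

import Mathlib

open scoped Manifold ContDiff

noncomputable section

/-- The standard coordinate space `ℝⁿ`. -/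
abbrev Coord (n : ℕ) : Type := EuclideanSpace ℝ (Fin n)

section Coordinates

variable {n : ℕ}

/-- The partial derivative `∂f / ∂xⁱ`. -/
def pderiv (i : Fin n) (f : Coord n → ℝ) (x : Coord n) : ℝ :=
  fderiv ℝ f x (EuclideanSpace.single i 1)

/-- The Christoffel symbol `Γᵏᵢⱼ` of the Levi-Civita connection of the metric `G`. -/
def christoffel (G : Coord n → Matrix (Fin n) (Fin n) ℝ) (k i j : Fin n) (x : Coord n) : ℝ :=
  (1 / 2) * ∑ l, (G x)⁻¹ k l * (pderiv i (fun y ↦ G y j l) x + pderiv j (fun y ↦ G y i l) x -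
    pderiv l (fun y ↦ G y i j) x)

/-- The `(0,4)` curvature tensor `Rᵢⱼₖₗ = ⟨R(∂ᵢ, ∂ⱼ) ∂ₖ, ∂ₗ⟩`, with the sign convention
`R(X, Y) = ∇_Y ∇_X - ∇_X ∇_Y + ∇_[X, Y]`, for which `⟨R(X, Y) X, Y⟩` is the sectional curvature of
the plane spanned by an orthonormal pair `X, Y`. -/
def riemann (G : Coord n → Matrix (Fin n) (Fin n) ℝ) (i j k l : Fin n) (x : Coord n) : ℝ :=
  ∑ m, G x l m * (pderiv j (christoffel G m i k) x - pderiv i (christoffel G m j k) x +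
    ∑ r, (christoffel G m j r x * christoffel G r i k x -
      christoffel G m i r x * christoffel G r j k x))

/-- The Ricci tensor: `Ric(X, Y)` is the trace of `R(X, ·, Y, ·)`. -/
def ricci (G : Coord n → Matrix (Fin n) (Fin n) ℝ) (i k : Fin n) (x : Coord n) : ℝ :=
  ∑ j, ∑ l, (G x)⁻¹ j l * riemann G i j k l x

/-- The scalar curvature. -/
def scalarCurvature (G : Coord n → Matrix (Fin n) (Fin n) ℝ) (x : Coord n) : ℝ :=
  ∑ i, ∑ k, (G x)⁻¹ i k * ricci G i k x

/-- The Schouten tensor (for `n ≥ 3`). -/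
def schouten (G : Coord n → Matrix (Fin n) (Fin n) ℝ) (i k : Fin n) (x : Coord n) : ℝ :=
  1 / ((n : ℝ) - 2) *
    (ricci G i k x - scalarCurvature G x / (2 * ((n : ℝ) - 1)) * G x i k)

/-- The Kulkarni-Nomizu product of two bilinear forms. -/
def kulkarniNomizu (α β : Matrix (Fin n) (Fin n) ℝ) (i j k l : Fin n) : ℝ :=
  α i k * β j l + β i k * α j l - α i l * β j k - α j k * β i l

/-- The `(0,4)` Weyl tensor, the trace-free part of the curvature tensor:
it is the curvature tensor minus the Kulkarni-Nomizu product of the Schouten tensor and the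
metric. -/
def weyl (G : Coord n → Matrix (Fin n) (Fin n) ℝ) (i j k l : Fin n) (x : Coord n) : ℝ :=
  riemann G i j k l x - kulkarniNomizu (Matrix.of fun a b ↦ schouten G a b x) (G x) i j k l

lemma riemann_swap (G : Coord n → Matrix (Fin n) (Fin n) ℝ) (i j k l : Fin n) (x : Coord n) :
    riemann G j i k l x = -riemann G i j k l x := by
  simp only [riemann, ← Finset.sum_neg_distrib, ← mul_neg]
  refine Finset.sum_congr rfl fun m _ ↦ congrArg _ ?_
  simp only [Finset.sum_sub_distrib]
  ring

lemma weyl_swap (G : Coord n → Matrix (Fin n) (Fin n) ℝ) (i j k l : Fin n) (x : Coord n) :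
    weyl G j i k l x = -weyl G i j k l x := by
  rw [weyl, weyl, riemann_swap, kulkarniNomizu, kulkarniNomizu]
  ring

/-- The semiclassical principal symbol
`|ξ|² - |dφ|² + 2 i ⟨ξ, dφ⟩` of the conjugated Laplacian `e^{φ/h} (-h² Δ) e^{-φ/h}`
in local coordinates `(x, ξ)` on the cotangent bundle. -/
def carlemanSymbol (G : Coord n → Matrix (Fin n) (Fin n) ℝ) (φ : Coord n → ℝ)
    (x ξ : Coord n) : ℂ :=
  ((∑ j, ∑ k, (G x)⁻¹ j k * (ξ j * ξ k - pderiv j φ x * pderiv k φ x) : ℝ) : ℂ) +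
    2 * Complex.I * ((∑ j, ∑ k, (G x)⁻¹ j k * (ξ j * pderiv k φ x) : ℝ) : ℂ)

/-- The Poisson bracket
`{a, b} = ∑ⱼ (∂a/∂ξⱼ ∂b/∂xʲ - ∂a/∂xʲ ∂b/∂ξⱼ)` of complex functions on the cotangent bundle. -/
def poissonBracket (a b : Coord n → Coord n → ℂ) (x ξ : Coord n) : ℂ :=
  ∑ j, (fderiv ℝ (fun η ↦ a x η) ξ (EuclideanSpace.single j 1) *
      fderiv ℝ (fun y ↦ b y ξ) x (EuclideanSpace.single j 1) -
    fderiv ℝ (fun y ↦ a y ξ) x (EuclideanSpace.single j 1) *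
      fderiv ℝ (fun η ↦ b x η) ξ (EuclideanSpace.single j 1))

end Coordinates

section Manifolds

variable {n : ℕ} {M : Type*} [TopologicalSpace M] [ChartedSpace (Coord n) M]
  [IsManifold (𝓡 n) ∞ M]

/-- A smooth Riemannian metric on a smooth `n`-manifold without boundary. -/
abbrev SmoothMetric (n : ℕ) (M : Type*) [TopologicalSpace M] [ChartedSpace (Coord n) M]
    [IsManifold (𝓡 n) ∞ M] : Type _ :=
  Bundle.ContMDiffRiemannianMetric (𝓡 n) ∞ (Coord n) (fun p : M ↦ TangentSpace (𝓡 n) p)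

/-- The components `gᵢⱼ = g(∂ᵢ, ∂ⱼ)` of a metric in the preferred chart around `p`. -/
def metricInChart (g : SmoothMetric n M) (p : M) (x : Coord n) : Matrix (Fin n) (Fin n) ℝ :=
  Matrix.of fun i j ↦ g.inner ((extChartAt (𝓡 n) p).symm x)
    (mfderiv 𝓘(ℝ, Coord n) (𝓡 n) (extChartAt (𝓡 n) p).symm x (EuclideanSpace.single i 1))
    (mfderiv 𝓘(ℝ, Coord n) (𝓡 n) (extChartAt (𝓡 n) p).symm x (EuclideanSpace.single j 1))

/-- The components of a tangent vector at `p` in the preferred chart around `p`. In Mathlib the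
tangent space at `p` is by definition the model space, through that chart. -/
def tangentCoord (p : M) : TangentSpace (𝓡 n) p ≃ₗ[ℝ] Coord n := LinearEquiv.refl ℝ (Coord n)

lemma tangentCoord_eq_mfderiv (p : M) (v : TangentSpace (𝓡 n) p) :
    tangentCoord p v = mfderiv (𝓡 n) (𝓡 n) (chartAt (Coord n) p) p v := by
  have h := tangentCoordChange_self (I := 𝓡 n) (v := tangentCoord p v) (mem_extChartAt_source p)
  rw [← mfderiv_chartAt_eq_tangentCoordChange (mem_chart_source (Coord n) p)] at h
  exact h.symm

/-- The coordinate vector `∂ᵢ` at `p`. -/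
def coordVector (p : M) (i : Fin n) : TangentSpace (𝓡 n) p :=
  (tangentCoord p).symm (EuclideanSpace.single i 1)

/-- The Weyl tensor of `g` at `p` as a multilinear form. -/
def weylTensor (g : SmoothMetric n M) (p : M) (v w y z : TangentSpace (𝓡 n) p) : ℝ :=
  ∑ i, ∑ j, ∑ k, ∑ l, weyl (metricInChart g p) i j k l (extChartAt (𝓡 n) p p) *
    (tangentCoord p v i * tangentCoord p w j * tangentCoord p y k * tangentCoord p z l)

/-- The space `Λ² T_p M` of bivectors. -/
abbrev Bivector (n : ℕ) {M : Type*} [TopologicalSpace M] [ChartedSpace (Coord n) M] (p : M) :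
    Type _ := ⋀[ℝ]^2 (TangentSpace (𝓡 n) p)

/-- The simple bivector `v ∧ w`. -/
def wedge {p : M} (v w : TangentSpace (𝓡 n) p) : Bivector n p :=
  exteriorPower.ιMulti ℝ 2 ![v, w]

/-- The inner product induced by `g` on bivectors:
`⟨x ∧ y, z ∧ t⟩ = g(x, z) g(y, t) - g(x, t) g(y, z)`. -/
def bivectorInner (g : SmoothMetric n M) (p : M) : Bivector n p →ₗ[ℝ] Bivector n p →ₗ[ℝ] ℝ :=
  exteriorPower.pairingDual ℝ (TangentSpace (𝓡 n) p) 2 ∘ₗ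
    exteriorPower.map 2 (ContinuousLinearMap.coeLM ℝ ∘ₗ (g.inner p).toLinearMap)

lemma bivectorInner_wedge (g : SmoothMetric n M) (p : M) (x y z t : TangentSpace (𝓡 n) p) :
    bivectorInner g p (wedge x y) (wedge z t) =
      g.inner p x z * g.inner p y t - g.inner p x t * g.inner p y z := by
  rw [bivectorInner, LinearMap.comp_apply, wedge, wedge, exteriorPower.map_apply_ιMulti,
    exteriorPower.pairingDual_ιMulti_ιMulti, Matrix.det_fin_two]
  simp [mul_comm]

/-- The alternating map given by an alternating bilinear map. -/
def alternatingOfBilinear {V N : Type*} [AddCommGroup V] [Module ℝ V] [AddCommGroup N] [Module ℝ N]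
    (B : V →ₗ[ℝ] V →ₗ[ℝ] N) (hB : ∀ v, B v v = 0) : V [⋀^Fin 2]→ₗ[ℝ] N where
  toFun v := B (v 0) (v 1)
  map_update_add' := by
    intro _ m i x y
    fin_cases i <;> simp
  map_update_smul' := by
    intro _ m i c x
    fin_cases i <;> simp
  map_eq_zero_of_eq' := by
    intro v i j h hij
    fin_cases i <;> fin_cases j <;> simp_all

lemma weylTensor_add_left (g : SmoothMetric n M) (p : M) (v v' w y z : TangentSpace (𝓡 n) p) :
    weylTensor g p (v + v') w y z = weylTensor g p v w y z + weylTensor g p v' w y z := by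
  simp only [weylTensor, map_add, PiLp.add_apply, add_mul, mul_add, Finset.sum_add_distrib]

lemma weylTensor_smul_left (g : SmoothMetric n M) (p : M) (c : ℝ)
    (v w y z : TangentSpace (𝓡 n) p) :
    weylTensor g p (c • v) w y z = c * weylTensor g p v w y z := by
  simp only [weylTensor, map_smul, PiLp.smul_apply, smul_eq_mul, Finset.mul_sum]
  refine Finset.sum_congr rfl fun i _ ↦ Finset.sum_congr rfl fun j _ ↦
    Finset.sum_congr rfl fun k _ ↦ Finset.sum_congr rfl fun l _ ↦ ?_
  ring

lemma weylTensor_swap (g : SmoothMetric n M) (p : M) (v w y z : TangentSpace (𝓡 n) p) :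
    weylTensor g p w v y z = -weylTensor g p v w y z := by
  simp only [weylTensor, ← Finset.sum_neg_distrib]
  rw [Finset.sum_comm]
  refine Finset.sum_congr rfl fun i _ ↦ Finset.sum_congr rfl fun j _ ↦
    Finset.sum_congr rfl fun k _ ↦ Finset.sum_congr rfl fun l _ ↦ ?_
  rw [weyl_swap]
  ring

/-- The bilinear map `(x, y) ↦ W(x ∧ y) = (1/2) ∑ W(x, y, ∂ₖ, ∂ₗ) gᵏᵃ gˡᵇ ∂ₐ ∧ ∂_b`, that is, the
form `W(x, y, ·, ·)` turned into a bivector by raising its indices. -/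
def weylBilinear (g : SmoothMetric n M) (p : M) :
    TangentSpace (𝓡 n) p →ₗ[ℝ] TangentSpace (𝓡 n) p →ₗ[ℝ] Bivector n p :=
  LinearMap.mk₂ ℝ
    (fun v w ↦ ∑ k, ∑ l, ∑ a, ∑ b,
      (weylTensor g p v w (coordVector p k) (coordVector p l) *
        ((1 / 2) * ((metricInChart g p (extChartAt (𝓡 n) p p))⁻¹ k a *
          (metricInChart g p (extChartAt (𝓡 n) p p))⁻¹ l b))) •
        wedge (coordVector p a) (coordVector p b))
    (fun v v' w ↦ by
      simp only [weylTensor_add_left, add_mul, add_smul, Finset.sum_add_distrib])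
    (fun c v w ↦ by
      simp only [weylTensor_smul_left, mul_assoc, mul_smul, Finset.smul_sum])
    (fun v w w' ↦ by
      simp only [weylTensor_swap g p _ v, weylTensor_add_left, neg_add, add_mul, add_smul,
        Finset.sum_add_distrib])
    (fun c v w ↦ by
      simp only [weylTensor_swap g p _ v, weylTensor_smul_left, ← mul_neg, mul_assoc, mul_smul,
        Finset.smul_sum])

lemma weylBilinear_self (g : SmoothMetric n M) (p : M) (v : TangentSpace (𝓡 n) p) :
    weylBilinear g p v v = 0 := by
  have h : ∀ y z, weylTensor g p v v y z = 0 := fun y z ↦ by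
    have := weylTensor_swap g p v v y z
    linarith
  simp [weylBilinear, h]

/-- The Weyl operator of `g` at `p`: the endomorphism of `Λ² T_p M` determined by
`⟨W(x ∧ y), z ∧ t⟩ = W(x, y, z, t)`. -/
def weylOperator (g : SmoothMetric n M) (p : M) : Bivector n p →ₗ[ℝ] Bivector n p :=
  exteriorPower.alternatingMapLinearEquiv
    (alternatingOfBilinear (weylBilinear g p) (weylBilinear_self g p))

/-- The eigenflag condition for an operator on bivectors: there is a nonzero tangent vector `v`
with `W(v ∧ v^⊥) ⊆ v ∧ v^⊥`. -/
def Eigenflag (g : SmoothMetric n M) (p : M) (W : Bivector n p →ₗ[ℝ] Bivector n p) : Prop :=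
  ∃ v : TangentSpace (𝓡 n) p, v ≠ 0 ∧
    ∀ w, g.inner p v w = 0 → ∃ w', g.inner p v w' = 0 ∧ W (wedge v w) = wedge v w'

/-- `φ` is a limiting Carleman weight for `g` on the open set `U`: it is smooth on `U`, its
differential vanishes nowhere on `U`, and the Poisson bracket `{p̄, p}` of the symbol `p` of the
conjugated Laplacian with its complex conjugate vanishes wherever `p` does, on the cotangent bundle
of `U`. -/
def IsLimitingCarlemanWeightOn (g : SmoothMetric n M) (U : Set M) (φ : M → ℝ) : Prop :=
  ContMDiffOn (𝓡 n) 𝓘(ℝ) ∞ φ U ∧ ∀ p ∈ U, mfderiv (𝓡 n) 𝓘(ℝ) φ p ≠ 0 ∧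
    ∀ ξ : Coord n,
      carlemanSymbol (metricInChart g p) (φ ∘ (extChartAt (𝓡 n) p).symm)
        (extChartAt (𝓡 n) p p) ξ = 0 →
      poissonBracket
        (fun x η ↦ starRingEnd ℂ (carlemanSymbol (metricInChart g p)
          (φ ∘ (extChartAt (𝓡 n) p).symm) x η))
        (carlemanSymbol (metricInChart g p) (φ ∘ (extChartAt (𝓡 n) p).symm))
        (extChartAt (𝓡 n) p p) ξ = 0

/-- Every point of `(M, g)` has an open neighbourhood isometric to an open subset of `(N, h)`. -/
def IsLocallyIsometricTo {N : Type*} [TopologicalSpace N] [ChartedSpace (Coord n) N]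
    [IsManifold (𝓡 n) ∞ N] (g : SmoothMetric n M) (h : SmoothMetric n N) : Prop :=
  ∀ p : M, ∃ f : OpenPartialHomeomorph M N, p ∈ f.source ∧
    ContMDiffOn (𝓡 n) (𝓡 n) ∞ f f.source ∧ ContMDiffOn (𝓡 n) (𝓡 n) ∞ f.symm f.target ∧
    ∀ q ∈ f.source, ∀ v w : TangentSpace (𝓡 n) q,
      h.inner (f q) (mfderiv (𝓡 n) (𝓡 n) f q v) (mfderiv (𝓡 n) (𝓡 n) f q w) = g.inner q v w

/-- In dimension `4`, for a positively oriented orthonormal basis `e` of `T_p M`, the eigenspace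
of the Hodge operator `*` for the eigenvalue `ε`. The bivector `*σ` is determined by
`σ ∧ τ = ⟨*σ, τ⟩ e₁ ∧ e₂ ∧ e₃ ∧ e₄` for all bivectors `τ`, so that `*σ = ε σ` says
`σ ∧ τ = ε ⟨σ, τ⟩ e₁ ∧ e₂ ∧ e₃ ∧ e₄` for all `τ`. -/
def hodgeEigenspace (g : SmoothMetric n M) (p : M) (e : Fin 4 → TangentSpace (𝓡 n) p) (ε : ℝ) :
    Submodule ℝ (Bivector n p) where
  carrier := {σ | ∀ τ : Bivector n p,
    (σ : ExteriorAlgebra ℝ (TangentSpace (𝓡 n) p)) * (τ : ExteriorAlgebra ℝ _) =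
      (ε * bivectorInner g p σ τ) • ExteriorAlgebra.ιMulti ℝ 4 e}
  add_mem' := by
    intro a b ha hb τ
    rw [Submodule.coe_add, add_mul, ha τ, hb τ, map_add, LinearMap.add_apply, mul_add, add_smul]
  zero_mem' := by
    intro τ
    simp
  smul_mem' := by
    intro c a ha τ
    rw [Submodule.coe_smul, smul_mul_assoc, ha τ, map_smul, LinearMap.smul_apply, smul_smul,
      smul_eq_mul, mul_left_comm]

/-- The bivectors `e₁ ∧ e₂ + e₃ ∧ e₄`, `e₁ ∧ e₃ - e₂ ∧ e₄`, `e₁ ∧ e₄ + e₂ ∧ e₃`. -/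
def selfDualFrame {p : M} (e : Fin 4 → TangentSpace (𝓡 n) p) : Fin 3 → Bivector n p :=
  ![wedge (e 0) (e 1) + wedge (e 2) (e 3), wedge (e 0) (e 2) - wedge (e 1) (e 3),
    wedge (e 0) (e 3) + wedge (e 1) (e 2)]

end Manifolds

/-- The complex projective plane, the space of complex lines in `ℂ³`. -/
def CP2 : Type := Projectivization ℂ (EuclideanSpace ℂ (Fin 3))

namespace CP2

/-- The quotient topology of `ℂ³ \ {0}`. -/
instance : TopologicalSpace CP2 :=
  inferInstanceAs (TopologicalSpace (Quotient (projectivizationSetoid ℂ (EuclideanSpace ℂ (Fin 3)))))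

/-- The point `[v]`. -/
def mk (v : EuclideanSpace ℂ (Fin 3)) (hv : v ≠ 0) : CP2 := Projectivization.mk ℂ v hv

/-- A vector spanning the line `p`. -/
def rep (p : CP2) : EuclideanSpace ℂ (Fin 3) := Projectivization.rep p

lemma rep_ne_zero (p : CP2) : p.rep ≠ 0 := Projectivization.rep_nonzero p

lemma exists_rep_mk (v : EuclideanSpace ℂ (Fin 3)) (hv : v ≠ 0) :
    ∃ a : ℂ, a ≠ 0 ∧ (mk v hv).rep = a • v := by
  obtain ⟨a, ha⟩ := Projectivization.exists_smul_eq_mk_rep ℂ v hv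
  exact ⟨a, a.ne_zero, ha.symm⟩

lemma mk_eq_of_rep (p : CP2) (v : EuclideanSpace ℂ (Fin 3)) (hv : v ≠ 0) (a : ℂ)
    (h : a • v = p.rep) : mk v hv = p := by
  have h1 : mk v hv = Projectivization.mk ℂ (Projectivization.rep p)
      (Projectivization.rep_nonzero p) := by
    symm
    exact (Projectivization.mk_eq_mk_iff' ℂ _ _ _ _).2 ⟨a, h⟩
  rw [h1]
  exact Projectivization.mk_rep p

lemma isQuotientMap_mk : Topology.IsQuotientMap
    (fun v : {v : EuclideanSpace ℂ (Fin 3) // v ≠ 0} ↦ mk v.1 v.2) :=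
  isQuotientMap_quot_mk

/-- A unitary frame of `ℂ³`. -/
abbrev Frame : Type := OrthonormalBasis (Fin 3) ℂ (EuclideanSpace ℂ (Fin 3))

/-- The vector `u₀ + z₁ u₁ + z₂ u₂`, where `z₁ = x₀ + i x₁` and `z₂ = x₂ + i x₃`. -/
def lift (u : Frame) (x : Coord 4) : EuclideanSpace ℂ (Fin 3) :=
  u 0 + (⟨x 0, x 1⟩ : ℂ) • u 1 + (⟨x 2, x 3⟩ : ℂ) • u 2

/-- The affine coordinates of `[v]`, for `v = w₀ u₀ + w₁ u₁ + w₂ u₂`: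
the real and imaginary parts of `w₁ / w₀` and `w₂ / w₀`. -/
def affine (u : Frame) (v : EuclideanSpace ℂ (Fin 3)) : Coord 4 :=
  !₂[(u.repr v 1 / u.repr v 0).re, (u.repr v 1 / u.repr v 0).im,
     (u.repr v 2 / u.repr v 0).re, (u.repr v 2 / u.repr v 0).im]

lemma repr_lift (u : Frame) (x : Coord 4) :
    u.repr (lift u x) 0 = 1 ∧ u.repr (lift u x) 1 = ⟨x 0, x 1⟩ ∧
      u.repr (lift u x) 2 = ⟨x 2, x 3⟩ := by
  refine ⟨?_, ?_, ?_⟩ <;> simp [lift, OrthonormalBasis.repr_self]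

lemma lift_ne_zero (u : Frame) (x : Coord 4) : lift u x ≠ 0 := by
  intro h
  have := (repr_lift u x).1
  rw [h] at this
  simp at this

lemma affine_lift (u : Frame) (x : Coord 4) : affine u (lift u x) = x := by
  obtain ⟨h0, h1, h2⟩ := repr_lift u x
  ext i
  fin_cases i <;> simp [affine, h0, h1, h2]

lemma lift_affine (u : Frame) (v : EuclideanSpace ℂ (Fin 3)) (hv : u.repr v 0 ≠ 0) :
    u.repr v 0 • lift u (affine u v) = v := by
  apply u.repr.injective
  obtain ⟨h0, h1, h2⟩ := repr_lift u (affine u v)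
  ext i
  fin_cases i
  · simp [h0]
  · simp [h1]
    simp [affine]
    field_simp
  · simp [h2]
    simp [affine]
    field_simp

lemma affine_smul (u : Frame) (a : ℂ) (ha : a ≠ 0) (v : EuclideanSpace ℂ (Fin 3)) :
    affine u (a • v) = affine u v := by
  simp [affine, mul_div_mul_left _ _ ha]

lemma affine_rep_mk (u : Frame) (v : EuclideanSpace ℂ (Fin 3)) (hv : v ≠ 0) :
    affine u (mk v hv).rep = affine u v := by
  obtain ⟨a, ha, h⟩ := exists_rep_mk v hv
  rw [h, affine_smul u a ha]

lemma repr_rep_mk (u : Frame) (v : EuclideanSpace ℂ (Fin 3)) (hv : v ≠ 0) :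
    u.repr (mk v hv).rep 0 ≠ 0 ↔ u.repr v 0 ≠ 0 := by
  obtain ⟨a, ha, h⟩ := exists_rep_mk v hv
  simp [h, ha]

lemma continuous_repr (u : Frame) (i : Fin 3) : Continuous fun v ↦ u.repr v i := by fun_prop

lemma isOpen_repr_ne (u : Frame) : IsOpen {p : CP2 | u.repr p.rep 0 ≠ 0} := by
  rw [← isQuotientMap_mk.isOpen_preimage]
  have : (fun v : {v : EuclideanSpace ℂ (Fin 3) // v ≠ 0} ↦ mk v.1 v.2) ⁻¹'
      {p | u.repr p.rep 0 ≠ 0} = {v | u.repr v.1 0 ≠ 0} := by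
    ext v
    exact repr_rep_mk u v.1 v.2
  rw [this]
  exact isOpen_ne_fun ((continuous_repr u 0).comp continuous_subtype_val) continuous_const

lemma contDiff_lift (u : Frame) : ContDiff ℝ ∞ (lift u) := by
  have h : ∀ a b : Fin 4, ContDiff ℝ ∞ fun x : Coord 4 ↦ (⟨x a, x b⟩ : ℂ) := by
    intro a b
    have : (fun x : Coord 4 ↦ (⟨x a, x b⟩ : ℂ)) =
        fun x : Coord 4 ↦ Complex.equivRealProdCLM.symm (x a, x b) := by
      ext x
      rfl
    rw [this]
    fun_prop
  have h1 := h 0 1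
  have h2 := h 2 3
  unfold lift
  fun_prop

/-- The affine chart of `CP²` given by a unitary frame `u`. Its inverse is
`(z₁, z₂) ↦ [u₀ + z₁ u₁ + z₂ u₂]`. -/
def chart (u : Frame) : OpenPartialHomeomorph CP2 (Coord 4) where
  toFun p := affine u p.rep
  invFun x := mk (lift u x) (lift_ne_zero u x)
  source := {p | u.repr p.rep 0 ≠ 0}
  target := Set.univ
  map_source' _ _ := trivial
  map_target' x _ := by
    change u.repr (mk (lift u x) _).rep 0 ≠ 0
    rw [repr_rep_mk, (repr_lift u x).1]
    exact one_ne_zero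
  left_inv' p hp := mk_eq_of_rep p _ _ (u.repr p.rep 0) (lift_affine u _ hp)
  right_inv' x _ := by rw [affine_rep_mk, affine_lift]
  open_source := isOpen_repr_ne u
  open_target := isOpen_univ
  continuousOn_toFun := by
    rw [isQuotientMap_mk.continuousOn_isOpen_iff (isOpen_repr_ne u)]
    have h : ∀ i, ContinuousOn (fun v : {v : EuclideanSpace ℂ (Fin 3) // v ≠ 0} ↦
        u.repr v.1 i / u.repr v.1 0) {v | u.repr v.1 0 ≠ 0} := fun i ↦
      ((continuous_repr u i).comp continuous_subtype_val).continuousOn.div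
        ((continuous_repr u 0).comp continuous_subtype_val).continuousOn fun v hv ↦ hv
    have h' : ContinuousOn (fun v : {v : EuclideanSpace ℂ (Fin 3) // v ≠ 0} ↦ affine u v.1)
        {v | u.repr v.1 0 ≠ 0} := by
      have h1 := h 1
      have h2 := h 2
      refine (PiLp.continuous_toLp 2 _).comp_continuousOn (continuousOn_pi.2 fun i ↦ ?_)
      fin_cases i
      · exact Complex.continuous_re.comp_continuousOn h1
      · exact Complex.continuous_im.comp_continuousOn h1
      · exact Complex.continuous_re.comp_continuousOn h2
      · exact Complex.continuous_im.comp_continuousOn h2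
    refine (h'.congr fun v _ ↦ ?_).mono fun v hv ↦ (repr_rep_mk u v.1 v.2).1 hv
    exact affine_rep_mk u v.1 v.2
  continuousOn_invFun := by
    have h : Continuous fun x : Coord 4 ↦
        (⟨lift u x, lift_ne_zero u x⟩ : {v : EuclideanSpace ℂ (Fin 3) // v ≠ 0}) :=
      (contDiff_lift u).continuous.subtype_mk _
    exact (isQuotientMap_mk.continuous.comp h).continuousOn

lemma exists_frame (p : CP2) : ∃ u : Frame, ∃ a : ℂ, a ≠ 0 ∧ p.rep = a • u 0 := by
  have hn : ‖p.rep‖ ≠ 0 := norm_ne_zero_iff.2 p.rep_ne_zero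
  let w : EuclideanSpace ℂ (Fin 3) := (‖p.rep‖ : ℂ)⁻¹ • p.rep
  have hw : ‖w‖ = 1 := by simp [w, norm_smul, hn]
  have ho : Orthonormal ℂ (({0} : Set (Fin 3)).domRestrict fun _ ↦ w) :=
    ⟨fun _ ↦ hw, fun i j hij ↦ (hij (Subsingleton.elim i j)).elim⟩
  obtain ⟨u, hu⟩ := ho.exists_orthonormalBasis_extension_of_card_eq (by simp)
  refine ⟨u, ‖p.rep‖, by exact_mod_cast hn, ?_⟩
  rw [hu 0 rfl, smul_smul, mul_inv_cancel₀ (by exact_mod_cast hn), one_smul]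

/-- A unitary frame whose first vector spans the line `p`. -/
def frameAt (p : CP2) : Frame := (exists_frame p).choose

lemma frameAt_spec (p : CP2) : ∃ a : ℂ, a ≠ 0 ∧ p.rep = a • frameAt p 0 :=
  (exists_frame p).choose_spec

/-- The atlas consists of the affine charts of all unitary frames; the preferred chart around `p` is
centred at `p`. -/
instance : ChartedSpace (Coord 4) CP2 where
  atlas := Set.range chart
  chartAt p := chart (frameAt p)
  mem_chart_source p := by
    obtain ⟨a, ha, h⟩ := frameAt_spec p
    change (frameAt p).repr p.rep 0 ≠ 0
    simp [h, ha]
  chart_mem_atlas p := ⟨_, rfl⟩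

lemma contDiffOn_affine_lift (u u' : Frame) :
    ContDiffOn ℝ ∞ (fun x ↦ affine u' (lift u x)) {x | u'.repr (lift u x) 0 ≠ 0} := by
  have hr : ∀ i, ContDiff ℝ ∞ fun x ↦ u'.repr (lift u x) i := by
    intro i
    have hl := contDiff_lift u
    have : ContDiff ℝ ∞ fun v ↦ u'.repr v i := by
      have h : (fun v ↦ u'.repr v i) = fun v ↦ inner ℂ (u' i) v := by
        ext v; exact u'.repr_apply_apply v i
      rw [h]
      exact ((innerSL ℂ (u' i)).restrictScalars ℝ).contDiff
    exact this.comp hl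
  have h : ∀ i, ContDiffOn ℝ ∞ (fun x ↦ u'.repr (lift u x) i / u'.repr (lift u x) 0)
      {x | u'.repr (lift u x) 0 ≠ 0} := fun i ↦
    ((hr i).contDiffOn.mul ((hr 0).contDiffOn.inv fun x hx ↦ hx)).congr
      fun x _ ↦ div_eq_mul_inv _ _
  have h1 := h 1
  have h2 := h 2
  rw [contDiffOn_piLp]
  intro i
  fin_cases i
  · exact Complex.reCLM.contDiff.comp_contDiffOn h1
  · exact Complex.imCLM.contDiff.comp_contDiffOn h1
  · exact Complex.reCLM.contDiff.comp_contDiffOn h2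
  · exact Complex.imCLM.contDiff.comp_contDiffOn h2

instance : IsManifold (𝓡 4) ∞ CP2 := by
  apply isManifold_of_contDiffOn
  rintro _ _ ⟨u, rfl⟩ ⟨u', rfl⟩
  refine ((contDiffOn_affine_lift u u').congr fun x _ ↦ ?_).mono fun x hx ↦ ?_
  · exact affine_rep_mk u' (lift u x) (lift_ne_zero u x)
  · have : u'.repr (mk (lift u x) (lift_ne_zero u x)).rep 0 ≠ 0 := hx.1.2
    exact (repr_rep_mk u' _ _).1 this


/-- Multiplication by `i` on `ℂ² = ℝ⁴`. -/
def complexStructure : Coord 4 →L[ℝ] Coord 4 :=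
  LinearMap.toContinuousLinearMap
    { toFun := fun x ↦ !₂[-x 1, x 0, -x 3, x 2]
      map_add' := fun x y ↦ by ext i; fin_cases i <;> simp [add_comm]
      map_smul' := fun c x ↦ by ext i; fin_cases i <;> simp }

lemma complexStructure_apply (x : Coord 4) :
    complexStructure x = !₂[-x 1, x 0, -x 3, x 2] := rfl

/-- The standard inner product of `ℝ⁴`. -/
def euclideanForm : Coord 4 →L[ℝ] Coord 4 →L[ℝ] ℝ := innerSL ℝ

/-- The Fubini-Study metric in an affine chart, at `z = x`:
`g(v, w) = Re (⟨v, w⟩ / (1 + |z|²) - ⟨v, z⟩ ⟨z, w⟩ / (1 + |z|²)²)` for the Hermitian product of `ℂ²`.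
This is the normalization that makes `S⁵ → CP²` a Riemannian submersion. -/
def fsForm (x : Coord 4) : Coord 4 →L[ℝ] Coord 4 →L[ℝ] ℝ :=
  (1 + ‖x‖ ^ 2)⁻¹ • euclideanForm -
    ((1 + ‖x‖ ^ 2) ^ 2)⁻¹ •
      ((innerSL ℝ x).smulRight (innerSL ℝ x) +
        (innerSL ℝ (complexStructure x)).smulRight (innerSL ℝ (complexStructure x)))

lemma fsForm_apply (x v w : Coord 4) :
    fsForm x v w = inner ℝ v w / (1 + ‖x‖ ^ 2) -
      (inner ℝ x v * inner ℝ x w +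
        inner ℝ (complexStructure x) v * inner ℝ (complexStructure x) w) / (1 + ‖x‖ ^ 2) ^ 2 := by
  have h : fsForm x v w = (1 + ‖x‖ ^ 2)⁻¹ * inner ℝ v w - ((1 + ‖x‖ ^ 2) ^ 2)⁻¹ *
      (inner ℝ x v * inner ℝ x w +
        inner ℝ (complexStructure x) v * inner ℝ (complexStructure x) w) := rfl
  rw [h]
  ring

lemma contDiff_fsForm : ContDiff ℝ ∞ fsForm := by
  rw [contDiff_clm_apply_iff]
  intro v
  rw [contDiff_clm_apply_iff]
  intro w
  simp only [fsForm_apply]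
  have h : ∀ x : Coord 4, 1 + ‖x‖ ^ 2 ≠ 0 := fun x ↦ by positivity
  have hn : ContDiff ℝ ∞ fun x : Coord 4 ↦ ‖x‖ ^ 2 := contDiff_norm_sq ℝ
  have hJ : ContDiff ℝ ∞ fun x : Coord 4 ↦ complexStructure x := complexStructure.contDiff
  have h1 : ∀ y : Coord 4, ContDiff ℝ ∞ fun x : Coord 4 ↦ inner ℝ x y := fun y ↦
    contDiff_id.inner ℝ contDiff_const
  have h2 : ∀ y : Coord 4, ContDiff ℝ ∞ fun x : Coord 4 ↦ inner ℝ (complexStructure x) y :=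
    fun y ↦ hJ.inner ℝ contDiff_const
  exact (contDiff_const.div (contDiff_const.add hn) h).sub
    ((((h1 v).mul (h1 w)).add ((h2 v).mul (h2 w))).div ((contDiff_const.add hn).pow 2)
      fun x ↦ pow_ne_zero 2 (h x))

lemma fsForm_zero (v w : Coord 4) : fsForm 0 v w = inner ℝ v w := by
  simp [fsForm_apply]

lemma chartAt_self (p : CP2) : chartAt (Coord 4) p p = 0 := by
  obtain ⟨a, ha, h⟩ := frameAt_spec p
  change affine (frameAt p) p.rep = 0
  rw [h]
  ext i
  fin_cases i <;> simp [affine]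

/-- The linear part of `lift u`. -/
def liftLin (u : Frame) : Coord 4 →L[ℝ] EuclideanSpace ℂ (Fin 3) :=
  LinearMap.toContinuousLinearMap
    { toFun := fun x ↦ (⟨x 0, x 1⟩ : ℂ) • u 1 + (⟨x 2, x 3⟩ : ℂ) • u 2
      map_add' := fun x y ↦ by
        have h : ∀ a b c d : ℝ, (⟨a + b, c + d⟩ : ℂ) = ⟨a, c⟩ + ⟨b, d⟩ := fun _ _ _ _ ↦ rfl
        simp only [PiLp.add_apply, h, add_smul]
        abel
      map_smul' := fun c x ↦ by
        have h : ∀ a b : ℝ, (⟨c * a, c * b⟩ : ℂ) = c • (⟨a, b⟩ : ℂ) := fun a b ↦ by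
          apply Complex.ext <;> simp
        simp only [PiLp.smul_apply, smul_eq_mul, h, smul_assoc, smul_add, RingHom.id_apply] }

lemma lift_eq (u : Frame) (x : Coord 4) : lift u x = u 0 + liftLin u x := by
  rw [lift, add_assoc]; rfl

lemma inner_liftLin (u : Frame) (x y : Coord 4) :
    inner ℂ (liftLin u x) (liftLin u y) =
      (⟨inner ℝ x y, inner ℝ (complexStructure x) y⟩ : ℂ) := by
  have h (z : Coord 4) : u.repr (liftLin u z) = !₂[0, (⟨z 0, z 1⟩ : ℂ), (⟨z 2, z 3⟩ : ℂ)] := by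
    change u.repr ((⟨z 0, z 1⟩ : ℂ) • u 1 + (⟨z 2, z 3⟩ : ℂ) • u 2) = _
    ext i
    fin_cases i <;> simp [OrthonormalBasis.repr_self]
  rw [← u.repr.inner_map_map, h, h]
  apply Complex.ext <;>
    simp [PiLp.inner_apply, Fin.sum_univ_succ, complexStructure_apply] <;> ring

lemma inner_lift_liftLin (u : Frame) (x y : Coord 4) :
    inner ℂ (lift u x) (liftLin u y) =
      (⟨inner ℝ x y, inner ℝ (complexStructure x) y⟩ : ℂ) := by
  rw [lift_eq, inner_add_left, inner_liftLin]
  have : inner ℂ (u 0) (liftLin u y) = 0 := by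
    change inner ℂ (u 0) ((⟨y 0, y 1⟩ : ℂ) • u 1 + (⟨y 2, y 3⟩ : ℂ) • u 2) = 0
    rw [inner_add_right, inner_smul_right, inner_smul_right]
    simp
  rw [this, zero_add]

lemma norm_lift (u : Frame) (x : Coord 4) : ‖lift u x‖ ^ 2 = 1 + ‖x‖ ^ 2 := by
  rw [EuclideanSpace.real_norm_sq_eq, ← u.repr.norm_map, EuclideanSpace.norm_sq_eq]
  obtain ⟨h0, h1, h2⟩ := repr_lift u x
  simp [Fin.sum_univ_succ] at *
  simp [h0, h1, h2, Complex.sq_norm, Complex.normSq_apply]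
  ring

lemma fderiv_affine_lift (u u' : Frame) (x : Coord 4) (a : ℂ) (ha : a ≠ 0)
    (h : lift u' x = a • u 0) (v : Coord 4) :
    fderiv ℝ (fun x ↦ affine u (lift u' x)) x v =
      !₂[(u.repr (liftLin u' v) 1 / a).re, (u.repr (liftLin u' v) 1 / a).im,
         (u.repr (liftLin u' v) 2 / a).re, (u.repr (liftLin u' v) 2 / a).im] := by
  have hl : HasFDerivAt (lift u') (liftLin u') x := by
    have : lift u' = fun x ↦ u' 0 + liftLin u' x := funext (lift_eq u')
    rw [this]
    exact (liftLin u').hasFDerivAt.const_add _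
  have hr : ∀ i, HasFDerivAt (fun x ↦ u.repr (lift u' x) i)
      (((innerSL ℂ (u i)).restrictScalars ℝ).comp (liftLin u')) x := by
    intro i
    have := ((innerSL ℂ (u i)).restrictScalars ℝ).hasFDerivAt.comp x hl
    refine this.congr_of_eventuallyEq (Filter.Eventually.of_forall fun y ↦ ?_)
    exact u.repr_apply_apply _ i
  have h0 : u.repr (lift u' x) 0 = a := by simp [h]
  have hq : ∀ i, i ≠ 0 → HasFDerivAt (fun x ↦ u.repr (lift u' x) i / u.repr (lift u' x) 0)
      (a⁻¹ • (((innerSL ℂ (u i)).restrictScalars ℝ).comp (liftLin u'))) x := by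
    intro i hi
    have hi0 : u.repr (lift u' x) i = 0 := by simp [h, hi]
    have hd : DifferentiableAt ℝ (fun x ↦ (u.repr (lift u' x) 0)⁻¹) x :=
      (hr 0).differentiableAt.inv (by rw [h0]; exact ha)
    have := (hr i).mul hd.hasFDerivAt
    simp only [div_eq_mul_inv]
    refine this.congr_fderiv ?_
    rw [hi0, h0]
    ext w
    simp
  have hc : ∀ i, i ≠ 0 → ∀ w, (a⁻¹ • (((innerSL ℂ (u i)).restrictScalars ℝ).comp (liftLin u'))) w =
      u.repr (liftLin u' w) i / a := by
    intro i _ w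
    rw [u.repr_apply_apply, div_eq_inv_mul]
    rfl
  have hd : DifferentiableAt ℝ (fun x ↦ affine u (lift u' x)) x := by
    have hm : {x | u.repr (lift u' x) 0 ≠ 0} ∈ nhds x := by
      refine IsOpen.mem_nhds (isOpen_ne_fun ?_ continuous_const) (by simp [h0, ha])
      exact (continuous_repr u 0).comp (contDiff_lift u').continuous
    exact (((contDiffOn_affine_lift u' u).contDiffAt hm).differentiableAt (by simp))
  have hcoord : ∀ j, fderiv ℝ (fun x ↦ affine u (lift u' x)) x v j =
      fderiv ℝ (fun x ↦ affine u (lift u' x) j) x v := by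
    intro j
    have := (EuclideanSpace.proj j : Coord 4 →L[ℝ] ℝ).hasFDerivAt.comp x hd.hasFDerivAt
    exact (congrArg (fun L : Coord 4 →L[ℝ] ℝ ↦ L v) this.fderiv).symm
  have hq1 := hq 1 (by simp)
  have hq2 := hq 2 (by simp)
  ext j
  rw [hcoord]
  fin_cases j
  · have := (Complex.reCLM.hasFDerivAt.comp x hq1).fderiv
    exact (congrArg (fun L : Coord 4 →L[ℝ] ℝ ↦ L v) this).trans
      (congrArg Complex.re (hc 1 (by simp) v))
  · have := (Complex.imCLM.hasFDerivAt.comp x hq1).fderiv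
    exact (congrArg (fun L : Coord 4 →L[ℝ] ℝ ↦ L v) this).trans
      (congrArg Complex.im (hc 1 (by simp) v))
  · have := (Complex.reCLM.hasFDerivAt.comp x hq2).fderiv
    exact (congrArg (fun L : Coord 4 →L[ℝ] ℝ ↦ L v) this).trans
      (congrArg Complex.re (hc 2 (by simp) v))
  · have := (Complex.imCLM.hasFDerivAt.comp x hq2).fderiv
    exact (congrArg (fun L : Coord 4 →L[ℝ] ℝ ↦ L v) this).trans
      (congrArg Complex.im (hc 2 (by simp) v))

/-- The differential of a change of charts, at a point sent to the centre, pulls the Euclidean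
inner product back to the Fubini-Study form. -/
lemma inner_fderiv_affine_lift (u u' : Frame) (x : Coord 4) (a : ℂ) (ha : a ≠ 0)
    (h : lift u' x = a • u 0) (v w : Coord 4) :
    inner ℝ (fderiv ℝ (fun x ↦ affine u (lift u' x)) x v)
      (fderiv ℝ (fun x ↦ affine u (lift u' x)) x w) = fsForm x v w := by
  rw [fderiv_affine_lift u u' x a ha h, fderiv_affine_lift u u' x a ha h]
  have hN : Complex.normSq a = 1 + ‖x‖ ^ 2 := by
    rw [← norm_lift u', h, norm_smul, u.norm_eq_one, mul_one, Complex.normSq_eq_norm_sq]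
  have hpos : (0 : ℝ) < 1 + ‖x‖ ^ 2 := by positivity
  have h0 (y : Coord 4) : (starRingEnd ℂ a) * u.repr (liftLin u' y) 0 =
      (⟨inner ℝ x y, inner ℝ (complexStructure x) y⟩ : ℂ) := by
    rw [← inner_lift_liftLin u', h, inner_smul_left, u.repr_apply_apply]
  have hsum := inner_liftLin u' v w
  rw [← u.repr.inner_map_map] at hsum
  simp only [PiLp.inner_apply, Fin.sum_univ_three, RCLike.inner_apply] at hsum
  rw [fsForm_apply, ← hN]
  have hN0 : Complex.normSq a ≠ 0 := by rw [hN]; exact hpos.ne'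
  have e1 := congrArg Complex.re hsum
  have ev := h0 v
  have ew := h0 w
  generalize u.repr (liftLin u' v) = V at *
  generalize u.repr (liftLin u' w) = W at *
  rw [Complex.ext_iff] at ev ew
  simp only [Complex.mul_re, Complex.mul_im, Complex.conj_re, Complex.conj_im,
    Complex.add_re] at ev ew e1
  have e2 : inner ℝ v w = ∑ x, w.ofLp x * (starRingEnd ℝ) (v.ofLp x) := rfl
  rw [← ev.1, ← ev.2, ← ew.1, ← ew.2, e2, ← e1]
  simp only [PiLp.inner_apply, Fin.sum_univ_four, RCLike.inner_apply, conj_trivial]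
  simp [Complex.div_re, Complex.div_im]
  rw [Complex.normSq_apply] at hN0 ⊢
  field_simp
  ring

/-- The Fubini-Study inner product on the tangent space at `p`, computed in the preferred chart. -/
def metricForm (p : CP2) : TangentSpace (𝓡 4) p →L[ℝ] TangentSpace (𝓡 4) p →L[ℝ] ℝ :=
  fsForm (chartAt (Coord 4) p p)

lemma metricForm_apply (p : CP2) (v w : Coord 4) : metricForm p v w = inner ℝ v w := by
  have h : metricForm p = fsForm 0 := congrArg fsForm (chartAt_self p)
  rw [h]
  exact fsForm_zero v w

lemma contMDiff_metricForm :
    ContMDiff (𝓡 4) ((𝓡 4).prod 𝓘(ℝ, Coord 4 →L[ℝ] Coord 4 →L[ℝ] ℝ)) ∞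
      (fun p : CP2 ↦ Bundle.TotalSpace.mk' (Coord 4 →L[ℝ] Coord 4 →L[ℝ] ℝ)
        (E := fun p : CP2 ↦ TangentSpace (𝓡 4) p →L[ℝ] TangentSpace (𝓡 4) p →L[ℝ] ℝ) p
        (metricForm p)) := by
  intro p₀
  rw [Bundle.contMDiffAt_section]
  have h1 : ContMDiffAt (𝓡 4) 𝓘(ℝ, Coord 4 →L[ℝ] Coord 4 →L[ℝ] ℝ) ∞
      (fun p : CP2 ↦ fsForm (chartAt (Coord 4) p₀ p)) p₀ :=
    contDiff_fsForm.contMDiff.contMDiffAt.comp p₀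
      (contMDiffOn_chart.contMDiffAt (chart_source_mem_nhds _ _))
  refine h1.congr_of_eventuallyEq ?_
  filter_upwards [chart_source_mem_nhds (Coord 4) p₀] with p hp
  ext v w
  have e : ContinuousLinearMap.inCoordinates (Coord 4) (TangentSpace (𝓡 4) (M := CP2))
      (Coord 4 →L[ℝ] ℝ) (fun p : CP2 ↦ TangentSpace (𝓡 4) p →L[ℝ] ℝ) p₀ p p₀ p (metricForm p) v w =
      metricForm p
        ((trivializationAt (Coord 4) (TangentSpace (𝓡 4)) p₀).symmL ℝ p v)
        ((trivializationAt (Coord 4) (TangentSpace (𝓡 4)) p₀).symmL ℝ p w) := by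
    rw [inCoordinates_apply_eq₂ (F₃ := ℝ) (E₃ := Bundle.Trivial CP2 ℝ) hp hp (Set.mem_univ p)]
    have hs : ∀ y : Coord 4, (trivializationAt (Coord 4) (TangentSpace (𝓡 4)) p₀).symm p y =
        (trivializationAt (Coord 4) (TangentSpace (𝓡 4)) p₀).symmL ℝ p y := fun y ↦
      (Bundle.Trivialization.symmL_apply (R := ℝ) _ hp y).symm
    simp only [Bundle.Trivial.fiberBundle_trivializationAt',
      Bundle.Trivial.linearMapAt_trivialization, LinearMap.id_apply]
    rw [hs v, hs w]
  refine e.trans ?_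
  rw [TangentBundle.symmL_trivializationAt_eq_core hp]
  refine (metricForm_apply p _ _).trans ?_
  have hD : (tangentBundleCore (𝓡 4) CP2).coordChange (achart (Coord 4) p₀) (achart (Coord 4) p) p =
      fderiv ℝ (fun x ↦ affine (frameAt p) (lift (frameAt p₀) x)) (chartAt (Coord 4) p₀ p) := by
    rw [← fderivWithin_univ]
    have hr : Set.range (𝓡 4) = Set.univ := by simp
    rw [← hr]
    refine (tangentCoordChange_def (I := 𝓡 4) (x := p₀) (y := p) (z := p)).trans ?_
    congr 1
    funext x
    exact affine_rep_mk _ _ (lift_ne_zero _ x)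
  rw [hD]
  obtain ⟨a, ha, h⟩ := frameAt_spec p
  have hp' : (frameAt p₀).repr p.rep 0 ≠ 0 := hp
  refine inner_fderiv_affine_lift _ _ _ (((frameAt p₀).repr p.rep 0)⁻¹ * a)
    (mul_ne_zero (inv_ne_zero hp') ha) ?_ v w
  rw [mul_smul, ← h, eq_inv_smul_iff₀ hp']
  exact lift_affine _ _ hp'

/-- The Fubini-Study metric of `CP²`. -/
def fubiniStudy : Bundle.ContMDiffRiemannianMetric (𝓡 4) ∞ (Coord 4)
    (fun p : CP2 ↦ TangentSpace (𝓡 4) p) where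
  inner := metricForm
  symm p v w := by
    rw [metricForm_apply p v w, metricForm_apply p w v]
    exact real_inner_comm _ _
  pos p v hv := by
    rw [metricForm_apply p v v]
    exact real_inner_self_pos.2 hv
  isVonNBounded p := by
    change Bornology.IsVonNBounded ℝ {v : Coord 4 | metricForm p v v < 1}
    have : {v : Coord 4 | metricForm p v v < 1} = Metric.ball (0 : Coord 4) 1 := by
      ext v
      have h : metricForm p v v = ‖v‖ ^ 2 :=
        (metricForm_apply p v v).trans (real_inner_self_eq_norm_sq _)
      rw [Set.mem_ofPred_eq, h, mem_ball_zero_iff]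
      exact sq_lt_one_iff₀ (norm_nonneg _)
    rw [this]
    exact NormedSpace.isVonNBounded_ball ℝ (Coord 4) 1
  contMDiff := contMDiff_metricForm

/-- The complex structure of `T_p CP²`: multiplication by `i` in the affine chart around `p`. -/
def J (p : CP2) : TangentSpace (𝓡 4) p →ₗ[ℝ] TangentSpace (𝓡 4) p :=
  (tangentCoord p).symm.toLinearMap ∘ₗ complexStructure.toLinearMap ∘ₗ (tangentCoord p).toLinearMap

/-- `e` is an orthonormal basis of `T_p CP²` of the form `e₁, J e₁, e₃, J e₃`. -/
def IsAdaptedFrame (p : CP2) (e : Fin 4 → TangentSpace (𝓡 4) p) : Prop :=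
  (∀ i j, fubiniStudy.inner p (e i) (e j) = if i = j then 1 else 0) ∧
    e 1 = J p (e 0) ∧ e 3 = J p (e 2)

end CP2

end

/-! All geometry is read in an affine chart centred at the point, where the Fubini-Study form agrees
with the Euclidean one to first order. The Christoffel symbols vanish at the centre, so the
curvature is a combination of the second derivatives `fsHessian`. The metric is Einstein with
Schouten tensor g; removing that part gives `weyl_fsMatrix`, which as an operator reads W(v ∧ w) =
Jv ∧ Jw - v ∧ w + 2⟨Jv, w⟩K, with K the Kähler bivector (`weylOperator_wedge`). As K is the same in
every adapted frame, the spectrum follows (`IsAdaptedFrame.weylOperator_frame`). The eigenflag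
condition fails because W(v ∧ Jv) is a nonzero multiple of K, and K is not divisible by any vector
(`not_eigenflag`).

The nonexistence of limiting Carleman weights is obtained directly from the curvature, not through
the eigenflag condition. On the zero set of the symbol the Poisson bracket is a nonzero multiple of
Hess φ(v, v) + Hess φ(∇φ, ∇φ), where v is dual to the covector, orthogonal to ∇φ and of the same
length (`hessCondition_of_poissonBracket`). By scaling and polarization the Hessian restricted to
ker dφ is proportional to g: the level sets of φ are umbilic. The Codazzi equation then forces R(a,
b, c, ∇φ) = 0 for pairwise orthogonal a, b, c tangent to a level set. But with N = ∇φ and y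
orthogonal to N and JN with |y| = |N|, one has R(JN, y, Jy, N) = |N|⁴ ≠ 0.

The Codazzi step takes the form of symmetry of third derivatives: `third_derivative_eq` expresses
the derivative of φ in the directions a, b, c at the centre through second derivatives of the
metric, and interchanging a and b gives the contradiction in `not_eventually_hessCondition`. The
Hessian condition is invariant under changes of coordinates (`hessCondition_of_pullback`), which
transfers the argument through local isometries; CP² itself is the case of the identity. -/

set_option maxSynthPendingDepth 3

/-! ### The Fubini-Study form to second order at the centre of an affine chart. -/

namespace CP2

/-- The first derivative of the Fubini-Study form. -/
lemma fderiv_fsForm_apply (x b v w : Coord 4) :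
    fderiv ℝ fsForm x b v w =
      -(2 * inner ℝ x b * inner ℝ v w +
        (inner ℝ b v * inner ℝ x w + inner ℝ x v * inner ℝ b w +
          inner ℝ (complexStructure b) v * inner ℝ (complexStructure x) w +
          inner ℝ (complexStructure x) v * inner ℝ (complexStructure b) w)) / (1 + ‖x‖ ^ 2) ^ 2 +
      4 * inner ℝ x b * (inner ℝ x v * inner ℝ x w +
        inner ℝ (complexStructure x) v * inner ℝ (complexStructure x) w) / (1 + ‖x‖ ^ 2) ^ 3 := by
  have hd : DifferentiableAt ℝ fsForm x := contDiff_fsForm.differentiable (by simp) x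
  -- Along the line x + t • b the form is an explicit rational function of t; uniqueness of the
  -- derivative identifies its derivative with the Fréchet derivative in the direction b.
  have h1 : HasDerivAt (fun t : ℝ ↦ fsForm (x + t • b) v w) (fderiv ℝ fsForm x b v w) 0 := by
    have hl : HasDerivAt (fun t : ℝ ↦ x + t • b) b 0 := by
      simpa using ((hasDerivAt_id (0 : ℝ)).smul_const b).const_add x
    have h0 : HasFDerivAt fsForm (fderiv ℝ fsForm x) (x + (0 : ℝ) • b) := by
      simpa using hd.hasFDerivAt
    have h : HasDerivAt (fun t : ℝ ↦ fsForm (x + t • b)) (fderiv ℝ fsForm x b) 0 :=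
      HasFDerivAt.comp_hasDerivAt (l := fsForm) (0 : ℝ) h0 hl
    have h2 := (h.clm_apply (hasDerivAt_const (0 : ℝ) v)).clm_apply (hasDerivAt_const (0 : ℝ) w)
    simpa using h2
  have hs : (1 : ℝ) + ‖x‖ ^ 2 ≠ 0 := by positivity
  have hlin : ∀ c d : ℝ, HasDerivAt (fun t : ℝ ↦ c + t * d) d 0 := fun c d ↦ by
    simpa using ((hasDerivAt_id (0 : ℝ)).mul_const d).const_add c
  have hn : HasDerivAt (fun t : ℝ ↦ 1 + ‖x + t • b‖ ^ 2) (2 * inner ℝ x b) 0 := by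
    have h := ((hlin (1 + ‖x‖ ^ 2) (2 * inner ℝ x b)).add
      (((hasDerivAt_id (0 : ℝ)).pow 2).mul_const (‖b‖ ^ 2)))
    refine (h.congr_deriv (by simp)).congr_of_eventuallyEq (Filter.Eventually.of_forall fun t ↦ ?_)
    simp only [norm_add_sq_real, inner_smul_right, norm_smul, Real.norm_eq_abs, mul_pow, sq_abs,
      Pi.add_apply, id, Pi.pow_apply]
    ring
  have hn0 : (1 : ℝ) + ‖x + (0 : ℝ) • b‖ ^ 2 ≠ 0 := by simpa using hs
  have hi : ∀ z : Coord 4, HasDerivAt (fun t : ℝ ↦ inner ℝ (x + t • b) z) (inner ℝ b z) 0 :=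
    fun z ↦ by
      simpa [inner_add_left, inner_smul_left] using hlin (inner ℝ x z) (inner ℝ b z)
  have hj : ∀ z : Coord 4, HasDerivAt (fun t : ℝ ↦ inner ℝ (complexStructure (x + t • b)) z)
      (inner ℝ (complexStructure b) z) 0 := fun z ↦ by
    simpa only [map_add, map_smul, inner_add_left, inner_smul_left, conj_trivial] using
      hlin (inner ℝ (complexStructure x) z) (inner ℝ (complexStructure b) z)
  have h2 := ((hasDerivAt_const (0 : ℝ) (inner ℝ v w)).div hn hn0).sub
    ((((hi v).mul (hi w)).add ((hj v).mul (hj w))).div (hn.pow 2) (pow_ne_zero 2 hn0))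
  have h3 := h1.unique (h2.congr_of_eventuallyEq
    (Filter.Eventually.of_forall fun t ↦ fsForm_apply _ _ _))
  rw [h3]
  simp only [zero_smul, add_zero, zero_mul, zero_sub, Pi.add_apply, Pi.mul_apply]
  field_simp
  simp only [Pi.pow_apply, zero_smul, add_zero]
  field_simp
  ring

lemma fderiv_fsForm_zero : fderiv ℝ fsForm 0 = 0 := by
  ext b v w
  simp [fderiv_fsForm_apply]

/-- The second derivative of the Fubini-Study form at the centre of an affine chart. -/
noncomputable def fsHessian (a b v w : Coord 4) : ℝ :=
  -(2 * inner ℝ a b * inner ℝ v w +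
    (inner ℝ b v * inner ℝ a w + inner ℝ a v * inner ℝ b w +
      inner ℝ (complexStructure b) v * inner ℝ (complexStructure a) w +
      inner ℝ (complexStructure a) v * inner ℝ (complexStructure b) w))

/-- The derivative at the centre of the first derivative of the Fubini-Study form, evaluated on
variable vectors: only their values at the centre matter, since the first derivative vanishes
there. -/
lemma hasDerivAt_fderiv_fsForm (a : Coord 4) {b v w : ℝ → Coord 4} (hb : ContinuousAt b 0)
    (hv : ContinuousAt v 0) (hw : ContinuousAt w 0) :
    HasDerivAt (fun t : ℝ ↦ fderiv ℝ fsForm (t • a) (b t) (v t) (w t))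
      (fsHessian a (b 0) (v 0) (w 0)) 0 := by
  -- The difference quotient of t * h t at 0 is h t itself, so continuity of h suffices. At t • a
  -- the first derivative of the form carries such a factor t, so b, v, w need not be
  -- differentiable.
  have key : ∀ h : ℝ → ℝ, ContinuousAt h 0 → HasDerivAt (fun t ↦ t * h t) (h 0) 0 := by
    intro h hh
    rw [hasDerivAt_iff_tendsto_slope_zero]
    refine (hh.tendsto.mono_left nhdsWithin_le_nhds).congr' ?_
    filter_upwards [self_mem_nhdsWithin] with t ht
    have : t ≠ 0 := ht
    simp [this]
  have hne : ∀ (n : ℕ) (t : ℝ), (1 + t ^ 2 * ‖a‖ ^ 2) ^ n ≠ 0 := fun n t ↦ by positivity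
  have h2 := key (fun t ↦ fsHessian a (b t) (v t) (w t) / (1 + t ^ 2 * ‖a‖ ^ 2) ^ 2 +
    t ^ 2 * (4 * inner ℝ a (b t) * (inner ℝ a (v t) * inner ℝ a (w t) +
        inner ℝ (complexStructure a) (v t) * inner ℝ (complexStructure a) (w t))) /
        (1 + t ^ 2 * ‖a‖ ^ 2) ^ 3) (by
      have := hne 2 0
      have := hne 3 0
      unfold fsHessian
      fun_prop (disch := assumption))
  refine (h2.congr_deriv (by simp)).congr_of_eventuallyEq (Filter.Eventually.of_forall fun t ↦ ?_)
  simp only [fderiv_fsForm_apply, map_smul, inner_smul_left, norm_smul, Real.norm_eq_abs,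
    mul_pow, sq_abs, conj_trivial, fsHessian]
  ring

lemma inner_complexStructure_self (x : Coord 4) : inner ℝ (complexStructure x) x = 0 := by
  simp [complexStructure_apply, PiLp.inner_apply, Fin.sum_univ_succ]
  ring

lemma inner_complexStructure_left (x y : Coord 4) :
    inner ℝ (complexStructure x) y = -inner ℝ x (complexStructure y) := by
  simp [complexStructure_apply, PiLp.inner_apply, Fin.sum_univ_succ]
  ring

lemma complexStructure_complexStructure (x : Coord 4) :
    complexStructure (complexStructure x) = -x := by
  ext i
  fin_cases i <;> simp [complexStructure_apply]

lemma inner_complexStructure_complexStructure (x y : Coord 4) :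
    inner ℝ (complexStructure x) (complexStructure y) = inner ℝ x y := by
  rw [inner_complexStructure_left, complexStructure_complexStructure, inner_neg_right, neg_neg]

/-- The Fubini-Study metric in an arbitrary affine chart. -/
lemma fubiniStudy_inner_mfderiv_chart_symm (u : Frame) (x v w : Coord 4) :
    fubiniStudy.inner ((chart u).symm x) (mfderiv (𝓡 4) (𝓡 4) (chart u).symm x v)
      (mfderiv (𝓡 4) (𝓡 4) (chart u).symm x w) = fsForm x v w := by
  set p : CP2 := (chart u).symm x with hp
  have hmd : MDifferentiableAt (𝓡 4) (𝓡 4) (chart u).symm x :=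
    ((contMDiffOn_symm_of_mem_maximalAtlas (I := 𝓡 4) (n := ∞)
      (IsManifold.subset_maximalAtlas (show chart u ∈ atlas (Coord 4) CP2 from ⟨u, rfl⟩))).contMDiffAt
      (by simp [chart])).mdifferentiableAt (by simp)
  -- Tangent vectors at p are coordinates in the preferred chart, that of `frameAt p`, so the
  -- derivative of the inverse chart is that of the transition map. That chart sends p to its
  -- centre, where the metric is Euclidean, and `inner_fderiv_affine_lift` applies.
  have hD : ∀ y : Coord 4, mfderiv (𝓡 4) (𝓡 4) (chart u).symm x y =
      fderiv ℝ (fun x ↦ affine (frameAt p) (lift u x)) x y := by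
    intro y
    rw [hmd.mfderiv]
    have hr : Set.range (𝓡 4) = Set.univ := by simp
    have hf : writtenInExtChartAt (𝓡 4) (𝓡 4) x (chart u).symm =
        fun x ↦ affine (frameAt p) (lift u x) := by
      funext z
      exact affine_rep_mk _ _ (lift_ne_zero _ z)
    rw [hf, hr, fderivWithin_univ]
    rfl
  obtain ⟨a, ha, h⟩ := frameAt_spec p
  obtain ⟨b, hb, h'⟩ := exists_rep_mk (lift u x) (lift_ne_zero u x)
  have e1 : fubiniStudy.inner p (mfderiv (𝓡 4) (𝓡 4) (chart u).symm x v)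
      (mfderiv (𝓡 4) (𝓡 4) (chart u).symm x w) =
      inner ℝ (fderiv ℝ (fun x ↦ affine (frameAt p) (lift u x)) x v)
        (fderiv ℝ (fun x ↦ affine (frameAt p) (lift u x)) x w) := by
    rw [hD, hD]
    exact metricForm_apply p _ _
  rw [e1]
  refine inner_fderiv_affine_lift _ _ _ (b⁻¹ * a) (mul_ne_zero (inv_ne_zero hb) ha) ?_ v w
  rw [mul_smul, ← h, eq_inv_smul_iff₀ hb]
  exact h'.symm

lemma metricInChart_fubiniStudy (p : CP2) (x : Coord 4) :
    metricInChart fubiniStudy p x = Matrix.of fun i j ↦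
      fsForm x (EuclideanSpace.single i 1) (EuclideanSpace.single j 1) := by
  ext i j
  exact fubiniStudy_inner_mfderiv_chart_symm (frameAt p) x _ _

lemma extChartAt_self (p : CP2) : extChartAt (𝓡 4) p p = 0 := chartAt_self p

end CP2

/-! ### Differentiability of the determinant and the inverse of a matrix field. -/

lemma DifferentiableAt.matrix_det {E : Type*} [NormedAddCommGroup E] [NormedSpace ℝ E] {n : ℕ}
    {G : E → Matrix (Fin n) (Fin n) ℝ} {x : E}
    (hG : ∀ i j, DifferentiableAt ℝ (fun y ↦ G y i j) x) :
    DifferentiableAt ℝ (fun y ↦ (G y).det) x := by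
  simp only [Matrix.det_apply]
  refine DifferentiableAt.fun_sum fun σ _ ↦ DifferentiableAt.const_smul ?_ _
  exact (HasFDerivAt.finsetProd fun i _ ↦ (hG (σ i) i).hasFDerivAt).differentiableAt

lemma DifferentiableAt.matrix_inv_apply {E : Type*} [NormedAddCommGroup E] [NormedSpace ℝ E]
    {n : ℕ} {G : E → Matrix (Fin n) (Fin n) ℝ} {x : E}
    (hG : ∀ i j, DifferentiableAt ℝ (fun y ↦ G y i j) x) (hdet : (G x).det ≠ 0) (i j : Fin n) :
    DifferentiableAt ℝ (fun y ↦ (G y)⁻¹ i j) x := by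
  simp only [Matrix.inv_def, Matrix.smul_apply, smul_eq_mul, Ring.inverse_eq_inv']
  refine (DifferentiableAt.matrix_det hG).inv hdet |>.mul ?_
  simp only [Matrix.adjugate_apply]
  refine DifferentiableAt.matrix_det fun k l ↦ ?_
  simp only [Matrix.updateRow_apply]
  split_ifs
  · exact differentiableAt_const _
  · exact hG k l

/-! ### Curvature and Weyl tensor of the Fubini-Study metric at the centre. -/

namespace CP2

/-- The matrix of the Fubini-Study form in an affine chart. -/
noncomputable def fsMatrix (x : Coord 4) : Matrix (Fin 4) (Fin 4) ℝ :=
  Matrix.of fun i j ↦ fsForm x (EuclideanSpace.single i 1) (EuclideanSpace.single j 1)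

lemma metricInChart_eq_fsMatrix (p : CP2) : metricInChart fubiniStudy p = fsMatrix :=
  funext fun x ↦ metricInChart_fubiniStudy p x

lemma inner_single_single (i j : Fin 4) :
    inner ℝ (EuclideanSpace.single i 1 : Coord 4) (EuclideanSpace.single j 1) =
      (1 : Matrix (Fin 4) (Fin 4) ℝ) i j := by
  rw [EuclideanSpace.inner_single_left]
  simp [Matrix.one_apply]

lemma fsMatrix_zero : fsMatrix 0 = 1 := by
  ext i j
  rw [fsMatrix, Matrix.of_apply, fsForm_zero, inner_single_single]

lemma pderiv_fsMatrix (i j k : Fin 4) (x : Coord 4) :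
    pderiv i (fun y ↦ fsMatrix y j k) x =
      fderiv ℝ fsForm x (EuclideanSpace.single i 1) (EuclideanSpace.single j 1)
        (EuclideanSpace.single k 1) := by
  have hd : DifferentiableAt ℝ fsForm x := contDiff_fsForm.differentiable (by simp) x
  have h := (hd.hasFDerivAt.clm_apply (hasFDerivAt_const (EuclideanSpace.single j 1) x)).clm_apply
    (hasFDerivAt_const (EuclideanSpace.single k 1) x)
  rw [pderiv, show (fun y ↦ fsMatrix y j k) = fun y ↦ fsForm y (EuclideanSpace.single j 1)
    (EuclideanSpace.single k 1) from rfl, h.fderiv]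
  simp

lemma differentiable_fsMatrix (i j : Fin 4) : Differentiable ℝ fun y ↦ fsMatrix y i j := by
  have hd : Differentiable ℝ fsForm := contDiff_fsForm.differentiable (by simp)
  exact (hd.clm_apply (differentiable_const _)).clm_apply (differentiable_const _)

lemma christoffel_fsMatrix (k i j : Fin 4) (x : Coord 4) :
    christoffel fsMatrix k i j x = (1 / 2) * ∑ l, (fsMatrix x)⁻¹ k l *
      (fderiv ℝ fsForm x (EuclideanSpace.single i 1) (EuclideanSpace.single j 1)
          (EuclideanSpace.single l 1) +
        fderiv ℝ fsForm x (EuclideanSpace.single j 1) (EuclideanSpace.single i 1)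
          (EuclideanSpace.single l 1) -
        fderiv ℝ fsForm x (EuclideanSpace.single l 1) (EuclideanSpace.single i 1)
          (EuclideanSpace.single j 1)) := by
  simp only [christoffel, pderiv_fsMatrix]

lemma christoffel_fsMatrix_zero (k i j : Fin 4) : christoffel fsMatrix k i j 0 = 0 := by
  simp [christoffel_fsMatrix, fderiv_fsForm_zero]

/-- The factor that multiplies the inverse metric vanishes at the centre, so the derivative of the
inverse metric drops out, and the inverse metric itself is the identity there. -/
lemma pderiv_christoffel_fsMatrix (m k i j : Fin 4) :
    pderiv m (christoffel fsMatrix k i j) 0 = (1 / 2) *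
      (fsHessian (EuclideanSpace.single m 1) (EuclideanSpace.single i 1) (EuclideanSpace.single j 1)
          (EuclideanSpace.single k 1) +
        fsHessian (EuclideanSpace.single m 1) (EuclideanSpace.single j 1)
          (EuclideanSpace.single i 1) (EuclideanSpace.single k 1) -
        fsHessian (EuclideanSpace.single m 1) (EuclideanSpace.single k 1)
          (EuclideanSpace.single i 1) (EuclideanSpace.single j 1)) := by
  set ε : Fin 4 → Coord 4 := fun i ↦ EuclideanSpace.single i 1
  have hK : ∀ l, DifferentiableAt ℝ (fun y ↦ (fsMatrix y)⁻¹ k l) 0 := fun l ↦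
    DifferentiableAt.matrix_inv_apply (fun i j ↦ (differentiable_fsMatrix i j) 0)
      (by simp [fsMatrix_zero]) k l
  have hD : DifferentiableAt ℝ (fderiv ℝ fsForm) 0 :=
    (contDiff_fsForm.fderiv_right (m := ∞) (by simp)).differentiable (by simp) 0
  have hD' : ∀ a b c, DifferentiableAt ℝ (fun y ↦ fderiv ℝ fsForm y (ε a) (ε b) (ε c)) 0 :=
    fun a b c ↦ ((hD.clm_apply (differentiableAt_const _)).clm_apply
      (differentiableAt_const _)).clm_apply (differentiableAt_const _)
  have hd : DifferentiableAt ℝ (christoffel fsMatrix k i j) 0 := by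
    refine DifferentiableAt.congr_of_eventuallyEq ?_
      (Filter.Eventually.of_forall (christoffel_fsMatrix k i j))
    exact (DifferentiableAt.fun_sum fun l _ ↦ (hK l).mul
      (((hD' i j l).add (hD' j i l)).sub (hD' l i j))).const_mul _
  have hl : HasDerivAt (fun t : ℝ ↦ t • ε m) (ε m) 0 := by
    simpa using (hasDerivAt_id (0 : ℝ)).smul_const (ε m)
  have h0 : HasFDerivAt (christoffel fsMatrix k i j) (fderiv ℝ (christoffel fsMatrix k i j) 0)
      ((0 : ℝ) • ε m) := by
    simpa using hd.hasFDerivAt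
  have h1 : HasDerivAt (fun t : ℝ ↦ christoffel fsMatrix k i j (t • ε m))
      (pderiv m (christoffel fsMatrix k i j) 0) 0 := 
    HasFDerivAt.comp_hasDerivAt (l := christoffel fsMatrix k i j) (0 : ℝ) h0 hl
  have hK' : ∀ l, HasDerivAt (fun t : ℝ ↦ (fsMatrix (t • ε m))⁻¹ k l)
      (fderiv ℝ (fun y ↦ (fsMatrix y)⁻¹ k l) 0 (ε m)) 0:= fun l ↦ by
    have : HasFDerivAt (fun y ↦ (fsMatrix y)⁻¹ k l) (fderiv ℝ (fun y ↦ (fsMatrix y)⁻¹ k l) 0)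
      ((0 : ℝ) • ε m) := by simpa using (hK l).hasFDerivAt
    exact this.comp_hasDerivAt (0 : ℝ) hl
  have hc : ∀ a b c, HasDerivAt (fun t : ℝ ↦ fderiv ℝ fsForm (t • ε m) (ε a) (ε b) (ε c))
      (fsHessian (ε m) (ε a) (ε b) (ε c)) 0 := fun a b c ↦
    hasDerivAt_fderiv_fsForm (ε m) continuousAt_const continuousAt_const continuousAt_const
  have h2 := (HasDerivAt.fun_sum (u := Finset.univ) fun l _ ↦ (hK' l).mul
      (((hc i j l).add (hc j i l)).sub (hc l i j))).const_mul (1 / 2 : ℝ)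
  have h3 := h1.unique (h2.congr_of_eventuallyEq
    (Filter.Eventually.of_forall fun t ↦ christoffel_fsMatrix k i j _))
  rw [h3]
  simp [fderiv_fsForm_zero, fsMatrix_zero, Matrix.one_apply, ε]

/-- The matrix of the standard complex structure. -/
noncomputable def omega (i j : Fin 4) : ℝ :=
  inner ℝ (complexStructure (EuclideanSpace.single i 1)) (EuclideanSpace.single j 1 : Coord 4)

lemma omega_swap (i j : Fin 4) : omega i j = -omega j i := by
  rw [omega, inner_complexStructure_left, real_inner_comm]
  rfl

/-- The products of Christoffel symbols vanish at the centre and only the second derivatives of the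
metric remain. The result is the curvature tensor of constant holomorphic sectional curvature 4: an
orthonormal pair x, y spans a plane of curvature 1 + 3⟨Jx, y⟩². -/
lemma riemann_fsMatrix (i j k l : Fin 4) :
    riemann fsMatrix i j k l 0 =
      (1 : Matrix (Fin 4) (Fin 4) ℝ) i k * (1 : Matrix (Fin 4) (Fin 4) ℝ) j l -
      (1 : Matrix (Fin 4) (Fin 4) ℝ) i l * (1 : Matrix (Fin 4) (Fin 4) ℝ) j k +
      omega i k * omega j l - omega i l * omega j k + 2 * (omega i j * omega k l) := by
  have hd' : ∀ a b : Fin 4, (1 : Matrix (Fin 4) (Fin 4) ℝ) a b = (1 : Matrix _ _ ℝ) b a :=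
    fun a b ↦ by simp [Matrix.one_apply, eq_comm]
  have ho : ∀ a b : Fin 4, inner ℝ (complexStructure (EuclideanSpace.single a 1))
      (EuclideanSpace.single b 1 : Coord 4) = omega a b := fun a b ↦ rfl
  simp only [riemann, christoffel_fsMatrix_zero, pderiv_christoffel_fsMatrix, fsMatrix_zero,
    fsHessian, inner_single_single, ho, mul_zero, sub_zero, Finset.sum_const_zero, add_zero]
  rw [Finset.sum_eq_single l (fun m _ hm ↦ by simp [Matrix.one_apply_ne hm.symm]) (by simp),
    Matrix.one_apply_eq]
  simp only [hd' j i, hd' k i, hd' l i, hd' k j, hd' l j, hd' l k, omega_swap j i, omega_swap k i,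
    omega_swap l i, omega_swap k j, omega_swap l j, omega_swap l k]
  ring

lemma omega_eq (i j : Fin 4) : omega i j =
    !![0, 1, 0, 0; -1, 0, 0, 0; 0, 0, 0, 1; 0, 0, -1, 0] i j := by
  fin_cases i <;> fin_cases j <;>
    simp [omega, complexStructure_apply, PiLp.inner_apply]

/-- The Einstein constant is 6 = 4 + 1 + 1: for a unit vector x the plane of x and Jx contributes 4,
and two orthogonal totally real planes contribute 1 each. -/
lemma ricci_fsMatrix (i k : Fin 4) :
    ricci fsMatrix i k 0 = 6 * (1 : Matrix (Fin 4) (Fin 4) ℝ) i k := by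
  simp only [ricci, fsMatrix_zero, riemann_fsMatrix, inv_one]
  have : ∀ j, ∀ f : Fin 4 → ℝ, ∑ l, (1 : Matrix (Fin 4) (Fin 4) ℝ) j l * f l = f j := fun j f ↦ by
    simp [Matrix.one_apply]
  simp only [this, omega_eq]
  fin_cases i <;> fin_cases k <;> simp [Fin.sum_univ_four, Matrix.one_apply] <;> norm_num

/-- With Ricci tensor 6g and scalar curvature 24 the Schouten tensor is g, and the Kulkarni-Nomizu
square of g is twice the curvature tensor of constant curvature 1. Subtracting it reverses the sign
of the constant curvature part. -/
lemma weyl_fsMatrix (i j k l : Fin 4) :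
    weyl fsMatrix i j k l 0 =
      omega i k * omega j l - omega i l * omega j k + 2 * (omega i j * omega k l) -
      ((1 : Matrix (Fin 4) (Fin 4) ℝ) i k * (1 : Matrix (Fin 4) (Fin 4) ℝ) j l -
      (1 : Matrix (Fin 4) (Fin 4) ℝ) i l * (1 : Matrix (Fin 4) (Fin 4) ℝ) j k) := by
  have hs : scalarCurvature fsMatrix 0 = 24 := by
    simp only [scalarCurvature, ricci_fsMatrix, fsMatrix_zero, inv_one]
    simp [Matrix.one_apply]
    norm_num
  have hS : ∀ a b, schouten fsMatrix a b 0 = (1 : Matrix (Fin 4) (Fin 4) ℝ) a b := fun a b ↦ by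
    simp only [schouten, ricci_fsMatrix, hs, fsMatrix_zero]
    norm_num
    ring
  simp only [weyl, riemann_fsMatrix, hS, kulkarniNomizu, fsMatrix_zero, Matrix.of_apply]
  ring

end CP2

/-! ### Algebra of bivectors. -/

section Bivectors

variable {n : ℕ} {M : Type*} [TopologicalSpace M] [ChartedSpace (Coord n) M] {p : M}

lemma wedge_add_left (v v' w : TangentSpace (𝓡 n) p) :
    wedge (v + v') w = wedge v w + wedge v' w := by
  have h := (exteriorPower.ιMulti ℝ 2).map_update_add ![v, w] 0 v v'
  have hu : ∀ x, Function.update ![v, w] 0 x = ![x, w] := fun x ↦ by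
    ext1 k
    fin_cases k <;> rfl
  rwa [hu, hu, hu] at h

lemma wedge_smul_left (c : ℝ) (v w : TangentSpace (𝓡 n) p) :
    wedge (c • v) w = c • wedge v w := by
  have h := (exteriorPower.ιMulti ℝ 2).map_update_smul ![v, w] 0 c v
  have hu : ∀ x, Function.update ![v, w] 0 x = ![x, w] := fun x ↦ by
    ext1 k
    fin_cases k <;> rfl
  rwa [hu, hu] at h

lemma wedge_self (v : TangentSpace (𝓡 n) p) : wedge v v = 0 :=
  (exteriorPower.ιMulti ℝ 2).map_eq_zero_of_eq ![v, v] (i := 0) (j := 1) rfl (by simp)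

lemma wedge_swap (v w : TangentSpace (𝓡 n) p) : wedge w v = -wedge v w := by
  simpa [wedge] using (exteriorPower.ιMulti ℝ 2).map_swap ![v, w] (i := 0) (j := 1) (by simp)

lemma wedge_add_right (v w w' : TangentSpace (𝓡 n) p) :
    wedge v (w + w') = wedge v w + wedge v w' := by
  rw [wedge_swap, wedge_add_left, wedge_swap v w, wedge_swap v w']
  module

lemma wedge_smul_right (c : ℝ) (v w : TangentSpace (𝓡 n) p) :
    wedge v (c • w) = c • wedge v w := by
  rw [wedge_swap, wedge_smul_left, wedge_swap v w]
  module

lemma wedge_neg_right (v w : TangentSpace (𝓡 n) p) : wedge v (-w) = -wedge v w := by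
  simpa using wedge_smul_right (-1) v w

lemma coe_wedge (v w : TangentSpace (𝓡 n) p) :
    (wedge v w : ExteriorAlgebra ℝ (TangentSpace (𝓡 n) p)) =
      ExteriorAlgebra.ι ℝ v * ExteriorAlgebra.ι ℝ w := by
  simp [wedge, ExteriorAlgebra.ιMulti_apply]

/-- Linear maps on bivectors that agree on the wedge products of vectors of a spanning family are
equal. -/
lemma bivector_linearMap_ext {N : Type*} [AddCommGroup N] [Module ℝ N]
    {m : ℕ} {e : Fin m → TangentSpace (𝓡 n) p} (he : Submodule.span ℝ (Set.range e) = ⊤)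
    {f g : Bivector n p →ₗ[ℝ] N} (h : ∀ i j, i < j → f (wedge (e i) (e j)) = g (wedge (e i) (e j))) :
    f = g := by
  have h' : ∀ i j, f (wedge (e i) (e j)) = g (wedge (e i) (e j)) := by
    intro i j
    rcases lt_trichotomy i j with hij | rfl | hij
    · exact h i j hij
    · simp [wedge_self]
    · rw [wedge_swap (e j) (e i), map_neg, map_neg, h j i hij]
  refine LinearMap.ext_on (exteriorPower.ιMulti_span_of_span ℝ 2 _ he) ?_
  rintro _ ⟨v, hv, rfl⟩
  obtain ⟨i, hi⟩ := hv ⟨0, rfl⟩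
  obtain ⟨j, hj⟩ := hv ⟨1, rfl⟩
  have hv' : v = ![e i, e j] := by
    ext1 k
    fin_cases k
    · exact hi.symm
    · exact hj.symm
  rw [hv']
  exact h' i j

lemma ι_mul_ι_swap (v w : TangentSpace (𝓡 n) p) :
    ExteriorAlgebra.ι ℝ v * ExteriorAlgebra.ι ℝ w =
      -(ExteriorAlgebra.ι ℝ w * ExteriorAlgebra.ι ℝ v) :=
  eq_neg_of_add_eq_zero_left (ExteriorAlgebra.ι_add_mul_swap v w)

end Bivectors

/-! ### Self-dual and anti-self-dual bivectors in an orthonormal frame. -/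

section Hodge

variable {M : Type*} [TopologicalSpace M] [ChartedSpace (Coord 4) M] [IsManifold (𝓡 4) ∞ M]
  {g : SmoothMetric 4 M} {p : M} {e : Fin 4 → TangentSpace (𝓡 4) p}

lemma linearIndependent_of_orthonormal
    (he : ∀ i j, g.inner p (e i) (e j) = if i = j then 1 else 0) : LinearIndependent ℝ e := by
  rw [Fintype.linearIndependent_iff]
  intro c hc i
  have h := congrArg (g.inner p (e i)) hc
  simpa [map_sum, he] using h

lemma span_range_of_orthonormal
    (he : ∀ i j, g.inner p (e i) (e j) = if i = j then 1 else 0) :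
    Submodule.span ℝ (Set.range e) = ⊤ := by
  have : FiniteDimensional ℝ (TangentSpace (𝓡 4) p) :=
    inferInstanceAs (FiniteDimensional ℝ (Coord 4))
  have hr : Module.finrank ℝ (TangentSpace (𝓡 4) p) = 4 := by
    change Module.finrank ℝ (Coord 4) = 4
    simp
  exact (linearIndependent_of_orthonormal he).span_eq_top_of_card_eq_finrank' (by simp [hr])

/-- The determinant with respect to the basis e factors through the fourth exterior power and takes
the value 1 on e. -/
lemma ιMulti_ne_zero_of_orthonormal
    (he : ∀ i j, g.inner p (e i) (e j) = if i = j then 1 else 0) :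
    ExteriorAlgebra.ιMulti ℝ 4 e ≠ 0 := by
  intro h0
  have h1 : exteriorPower.ιMulti ℝ 4 e = 0 := Subtype.ext h0
  let b := Module.Basis.mk (linearIndependent_of_orthonormal he) (span_range_of_orthonormal he).ge
  have h2 : (b.det : TangentSpace (𝓡 4) p [⋀^Fin 4]→ₗ[ℝ] ℝ) e = 1 := by
    rw [← b.det_self]
    congr 1
    ext1 i
    exact (Module.Basis.mk_apply _ _ i).symm
  rw [← exteriorPower.alternatingMapLinearEquiv_apply_ιMulti, h1, map_zero] at h2
  exact zero_ne_one h2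

/-- The expansion of a bivector in an orthonormal frame. -/
lemma bivector_expand (he : ∀ i j, g.inner p (e i) (e j) = if i = j then 1 else 0)
    (σ : Bivector 4 p) :
    σ = bivectorInner g p σ (wedge (e 0) (e 1)) • wedge (e 0) (e 1) +
      bivectorInner g p σ (wedge (e 0) (e 2)) • wedge (e 0) (e 2) +
      bivectorInner g p σ (wedge (e 0) (e 3)) • wedge (e 0) (e 3) +
      bivectorInner g p σ (wedge (e 1) (e 2)) • wedge (e 1) (e 2) +
      bivectorInner g p σ (wedge (e 1) (e 3)) • wedge (e 1) (e 3) +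
      bivectorInner g p σ (wedge (e 2) (e 3)) • wedge (e 2) (e 3) := by
  let T : Fin 4 → Fin 4 → Bivector 4 p →ₗ[ℝ] Bivector 4 p := fun i j ↦
    ((bivectorInner g p).flip (wedge (e i) (e j))).smulRight (wedge (e i) (e j))
  have h : (LinearMap.id : Bivector 4 p →ₗ[ℝ] Bivector 4 p) =
      T 0 1 + T 0 2 + T 0 3 + T 1 2 + T 1 3 + T 2 3 := by
    refine bivector_linearMap_ext (span_range_of_orthonormal he) fun i j hij ↦ ?_
    fin_cases i <;> fin_cases j <;> first | exact absurd hij (by decide) |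
      simp [T, bivectorInner_wedge, he]
  exact LinearMap.congr_fun h σ

/-- The anti-self-dual bivectors `e₁ ∧ e₂ - e₃ ∧ e₄`, `e₁ ∧ e₃ + e₂ ∧ e₄`, `e₁ ∧ e₄ - e₂ ∧ e₃`. -/
noncomputable def antiSelfDualFrame (e : Fin 4 → TangentSpace (𝓡 4) p) : Fin 3 → Bivector 4 p :=
  ![wedge (e 0) (e 1) - wedge (e 2) (e 3), wedge (e 0) (e 2) + wedge (e 1) (e 3),
    wedge (e 0) (e 3) - wedge (e 1) (e 2)]

lemma bivector_eq_sum_selfDual_add_antiSelfDual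
    (he : ∀ i j, g.inner p (e i) (e j) = if i = j then 1 else 0) (σ : Bivector 4 p) :
    σ = ∑ i, (bivectorInner g p σ (selfDualFrame e i) / 2) • selfDualFrame e i +
      ∑ i, (bivectorInner g p σ (antiSelfDualFrame e i) / 2) • antiSelfDualFrame e i := by
  conv_lhs => rw [bivector_expand he σ]
  simp only [Fin.sum_univ_three, selfDualFrame, antiSelfDualFrame, Matrix.cons_val_zero,
    Matrix.cons_val_one, Matrix.cons_val, map_add, map_sub]
  module

/-- To check that a bivector lies in an eigenspace of the Hodge operator it suffices to test it
against the wedge products of the frame vectors. -/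
lemma mem_hodgeEigenspace_of_frame
    (he : ∀ i j, g.inner p (e i) (e j) = if i = j then 1 else 0) {ε : ℝ} {σ : Bivector 4 p}
    (h : ∀ i j, i < j → (σ : ExteriorAlgebra ℝ (TangentSpace (𝓡 4) p)) *
      (ExteriorAlgebra.ι ℝ (e i) * ExteriorAlgebra.ι ℝ (e j)) =
      (ε * bivectorInner g p σ (wedge (e i) (e j))) • ExteriorAlgebra.ιMulti ℝ 4 e) :
    σ ∈ hodgeEigenspace g p e ε := by
  have h' : LinearMap.mulLeft ℝ (σ : ExteriorAlgebra ℝ (TangentSpace (𝓡 4) p)) ∘ₗ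
      (⋀[ℝ]^2 (TangentSpace (𝓡 4) p)).subtype =
      (ε • bivectorInner g p σ).smulRight (ExteriorAlgebra.ιMulti ℝ 4 e) := by
    refine bivector_linearMap_ext (span_range_of_orthonormal he) fun i j hij ↦ ?_
    simpa [coe_wedge] using h i j hij
  exact fun τ ↦ LinearMap.congr_fun h' τ

set_option maxHeartbeats 1600000 in
lemma frame_mem_hodgeEigenspace
    (he : ∀ i j, g.inner p (e i) (e j) = if i = j then 1 else 0) (i : Fin 3) :
    selfDualFrame e i ∈ hodgeEigenspace g p e 1 ∧
      antiSelfDualFrame e i ∈ hodgeEigenspace g p e (-1) := by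
  -- These rules sort the factors of a monomial by index and kill repetitions; the condition j < i
  -- makes the rewriting terminate. Each product then becomes 0 or plus or minus the volume element
  -- in `hv`.
  have hs : ∀ i j : Fin 4, j < i → ExteriorAlgebra.ι ℝ (e i) * ExteriorAlgebra.ι ℝ (e j) =
      -(ExteriorAlgebra.ι ℝ (e j) * ExteriorAlgebra.ι ℝ (e i)) := fun i j _ ↦ ι_mul_ι_swap _ _
  have hs' : ∀ i j : Fin 4, j < i → ∀ z, ExteriorAlgebra.ι ℝ (e i) *
      (ExteriorAlgebra.ι ℝ (e j) * z) =
      -(ExteriorAlgebra.ι ℝ (e j) * (ExteriorAlgebra.ι ℝ (e i) * z)) := fun i j h z ↦ by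
    rw [← mul_assoc, hs i j h, neg_mul, mul_assoc]
  have hq : ∀ i : Fin 4, ExteriorAlgebra.ι ℝ (e i) * ExteriorAlgebra.ι ℝ (e i) = 0 := fun i ↦
    ExteriorAlgebra.ι_sq_zero _
  have hq' : ∀ i : Fin 4, ∀ z, ExteriorAlgebra.ι ℝ (e i) * (ExteriorAlgebra.ι ℝ (e i) * z) = 0 :=
    fun i z ↦ by rw [← mul_assoc, hq, zero_mul]
  have hv : ExteriorAlgebra.ιMulti ℝ 4 e = ExteriorAlgebra.ι ℝ (e 0) *
      (ExteriorAlgebra.ι ℝ (e 1) * (ExteriorAlgebra.ι ℝ (e 2) * ExteriorAlgebra.ι ℝ (e 3))) := by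
    simp [ExteriorAlgebra.ιMulti_apply]
    rfl
  refine ⟨mem_hodgeEigenspace_of_frame he fun k l hkl ↦ ?_,
    mem_hodgeEigenspace_of_frame he fun k l hkl ↦ ?_⟩ <;> rw [hv] <;>
  fin_cases i <;> fin_cases k <;> fin_cases l <;> first | exact absurd hkl (by decide) |
    simp [selfDualFrame, antiSelfDualFrame, coe_wedge, add_mul, sub_mul, mul_assoc, hs, hs', hq,
      hq', bivectorInner_wedge, he]

/-- As the volume element is nonzero, a common element σ satisfies ⟨σ, τ⟩ = -⟨σ, τ⟩ for every τ, so
all its frame components vanish. -/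
lemma disjoint_hodgeEigenspace
    (he : ∀ i j, g.inner p (e i) (e j) = if i = j then 1 else 0) :
    Disjoint (hodgeEigenspace g p e 1) (hodgeEigenspace g p e (-1)) := by
  rw [Submodule.disjoint_def]
  intro σ h1 h2
  have h : ∀ τ, bivectorInner g p σ τ = 0 := by
    intro τ
    have h3 := (h1 τ).symm.trans (h2 τ)
    rw [← sub_eq_zero, ← sub_smul] at h3
    have h4 := (smul_eq_zero.1 h3).resolve_right (ιMulti_ne_zero_of_orthonormal he)
    linarith
  rw [bivector_expand he σ]
  simp [h]

lemma isCompl_hodgeEigenspace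
    (he : ∀ i j, g.inner p (e i) (e j) = if i = j then 1 else 0) :
    IsCompl (hodgeEigenspace g p e 1) (hodgeEigenspace g p e (-1)) := by
  refine ⟨disjoint_hodgeEigenspace he, ?_⟩
  rw [codisjoint_iff, eq_top_iff]
  intro σ _
  rw [bivector_eq_sum_selfDual_add_antiSelfDual he σ]
  exact Submodule.add_mem_sup
    (Submodule.sum_mem _ fun i _ ↦ Submodule.smul_mem _ _ (frame_mem_hodgeEigenspace he i).1)
    (Submodule.sum_mem _ fun i _ ↦ Submodule.smul_mem _ _ (frame_mem_hodgeEigenspace he i).2)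

/-- The difference of σ and its self-dual part is self-dual, and by the expansion it is also the
anti-self-dual part; hence it is zero. -/
lemma eq_sum_of_mem_hodgeEigenspace_one
    (he : ∀ i j, g.inner p (e i) (e j) = if i = j then 1 else 0) {σ : Bivector 4 p}
    (hσ : σ ∈ hodgeEigenspace g p e 1) :
    σ = ∑ i, (bivectorInner g p σ (selfDualFrame e i) / 2) • selfDualFrame e i := by
  have h := bivector_eq_sum_selfDual_add_antiSelfDual he σ
  rw [← sub_eq_zero]
  refine (Submodule.disjoint_def.1 (disjoint_hodgeEigenspace he)) _
    (Submodule.sub_mem _ hσ (Submodule.sum_mem _ fun i _ ↦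
      Submodule.smul_mem _ _ (frame_mem_hodgeEigenspace he i).1)) ?_
  rw [sub_eq_of_eq_add' h]
  exact Submodule.sum_mem _ fun i _ ↦ Submodule.smul_mem _ _ (frame_mem_hodgeEigenspace he i).2

lemma eq_sum_of_mem_hodgeEigenspace_neg_one
    (he : ∀ i j, g.inner p (e i) (e j) = if i = j then 1 else 0) {σ : Bivector 4 p}
    (hσ : σ ∈ hodgeEigenspace g p e (-1)) :
    σ = ∑ i, (bivectorInner g p σ (antiSelfDualFrame e i) / 2) • antiSelfDualFrame e i := by
  have h := bivector_eq_sum_selfDual_add_antiSelfDual he σ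
  rw [← sub_eq_zero]
  refine (Submodule.disjoint_def.1 (disjoint_hodgeEigenspace he)) _ ?_
    (Submodule.sub_mem _ hσ (Submodule.sum_mem _ fun i _ ↦
      Submodule.smul_mem _ _ (frame_mem_hodgeEigenspace he i).2))
  rw [sub_eq_of_eq_add h]
  exact Submodule.sum_mem _ fun i _ ↦ Submodule.smul_mem _ _ (frame_mem_hodgeEigenspace he i).1

/-- The self-dual frame as a basis of the space of self-dual bivectors. -/
lemma exists_basis_hodgeEigenspace_one
    (he : ∀ i j, g.inner p (e i) (e j) = if i = j then 1 else 0) :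
    ∃ b : Module.Basis (Fin 3) ℝ (hodgeEigenspace g p e 1),
      ∀ i, (b i : Bivector 4 p) = selfDualFrame e i := by
  let v : Fin 3 → hodgeEigenspace g p e 1 := fun i ↦
    ⟨selfDualFrame e i, (frame_mem_hodgeEigenspace he i).1⟩
  have hli : LinearIndependent ℝ v := by
    rw [Fintype.linearIndependent_iff]
    intro c hc i
    have h1 : ∑ i, c i • selfDualFrame e i = 0 := by
      simpa [v] using congrArg Subtype.val hc
    have h2 := congrArg (fun σ ↦ bivectorInner g p σ (selfDualFrame e i)) h1
    rw [Fin.sum_univ_three] at h2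
    fin_cases i <;> simp [selfDualFrame, bivectorInner_wedge, he] at h2 ⊢ <;> linarith
  have hsp : ⊤ ≤ Submodule.span ℝ (Set.range v) := by
    rintro ⟨σ, hσ⟩ _
    have h : (⟨σ, hσ⟩ : hodgeEigenspace g p e 1) =
        ∑ i, (bivectorInner g p σ (selfDualFrame e i) / 2) • v i := by
      apply Subtype.ext
      simpa [v] using eq_sum_of_mem_hodgeEigenspace_one he hσ
    rw [h]
    exact Submodule.sum_mem _ fun i _ ↦ Submodule.smul_mem _ _ (Submodule.subset_span ⟨i, rfl⟩)
  exact ⟨Module.Basis.mk hli hsp, fun i ↦ by simp [v]⟩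

end Hodge

/-! ### The Weyl operator of the Fubini-Study metric and the failure of the eigenflag condition. -/

namespace CP2

variable {p : CP2}

lemma tangentCoord_J (v : TangentSpace (𝓡 4) p) :
    tangentCoord p (J p v) = complexStructure (tangentCoord p v) := rfl

lemma fubiniStudy_inner (v w : TangentSpace (𝓡 4) p) :
    fubiniStudy.inner p v w = inner ℝ (tangentCoord p v) (tangentCoord p w) :=
  metricForm_apply p v w

lemma inner_complexStructure_eq (x y : Coord 4) :
    inner ℝ (complexStructure x) y = x 0 * y 1 - x 1 * y 0 + x 2 * y 3 - x 3 * y 2 := by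
  simp [complexStructure_apply, PiLp.inner_apply, Fin.sum_univ_four]
  ring

lemma inner_coord_eq (x y : Coord 4) :
    inner ℝ x y = x 0 * y 0 + x 1 * y 1 + x 2 * y 2 + x 3 * y 3 := by
  simp [PiLp.inner_apply, Fin.sum_univ_four]
  ring

/-- The Weyl tensor of the Fubini-Study metric. -/
lemma weylTensor_fubiniStudy (v w y z : TangentSpace (𝓡 4) p) :
    weylTensor fubiniStudy p v w y z =
      fubiniStudy.inner p (J p v) y * fubiniStudy.inner p (J p w) z -
      fubiniStudy.inner p (J p v) z * fubiniStudy.inner p (J p w) y +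
      2 * (fubiniStudy.inner p (J p v) w * fubiniStudy.inner p (J p y) z) -
      (fubiniStudy.inner p v y * fubiniStudy.inner p w z -
        fubiniStudy.inner p v z * fubiniStudy.inner p w y) := by
  simp only [fubiniStudy_inner, tangentCoord_J, inner_complexStructure_eq]
  simp only [inner_coord_eq]
  simp only [weylTensor, metricInChart_eq_fsMatrix, extChartAt_self, weyl_fsMatrix, omega_eq]
  generalize tangentCoord p v = v
  generalize tangentCoord p w = w
  generalize tangentCoord p y = y
  generalize tangentCoord p z = z
  simp [Fin.sum_univ_four, Matrix.one_apply]
  ring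

lemma fubiniStudy_inner_coordVector (v : TangentSpace (𝓡 4) p) (i : Fin 4) :
    fubiniStudy.inner p v (coordVector p i) = tangentCoord p v i := by
  rw [fubiniStudy_inner, coordVector, LinearEquiv.apply_symm_apply,
    EuclideanSpace.inner_single_right]
  simp

lemma fubiniStudy_inner_J_coordVector (i j : Fin 4) :
    fubiniStudy.inner p (J p (coordVector p i)) (coordVector p j) = omega i j := by
  rw [fubiniStudy_inner, tangentCoord_J, coordVector, coordVector, LinearEquiv.apply_symm_apply,
    LinearEquiv.apply_symm_apply]
  rfl

lemma eq_sum_coordVector (v : TangentSpace (𝓡 4) p) :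
    v = tangentCoord p v 0 • coordVector p 0 + tangentCoord p v 1 • coordVector p 1 +
      tangentCoord p v 2 • coordVector p 2 + tangentCoord p v 3 • coordVector p 3 := by
  apply (tangentCoord p).injective
  simp only [map_add, map_smul, coordVector, LinearEquiv.apply_symm_apply]
  ext i
  fin_cases i <;> simp

lemma wedge_eq_sum (v w : TangentSpace (𝓡 4) p) :
    wedge v w =
      (tangentCoord p v 0 * tangentCoord p w 1 - tangentCoord p v 1 * tangentCoord p w 0) •
        wedge (coordVector p 0) (coordVector p 1) +
      (tangentCoord p v 0 * tangentCoord p w 2 - tangentCoord p v 2 * tangentCoord p w 0) •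
        wedge (coordVector p 0) (coordVector p 2) +
      (tangentCoord p v 0 * tangentCoord p w 3 - tangentCoord p v 3 * tangentCoord p w 0) •
        wedge (coordVector p 0) (coordVector p 3) +
      (tangentCoord p v 1 * tangentCoord p w 2 - tangentCoord p v 2 * tangentCoord p w 1) •
        wedge (coordVector p 1) (coordVector p 2) +
      (tangentCoord p v 1 * tangentCoord p w 3 - tangentCoord p v 3 * tangentCoord p w 1) •
        wedge (coordVector p 1) (coordVector p 3) +
      (tangentCoord p v 2 * tangentCoord p w 3 - tangentCoord p v 3 * tangentCoord p w 2) •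
        wedge (coordVector p 2) (coordVector p 3) := by
  conv_lhs => rw [eq_sum_coordVector v, eq_sum_coordVector w]
  generalize tangentCoord p v = v
  generalize tangentCoord p w = w
  simp only [wedge_add_left, wedge_add_right, wedge_smul_left, wedge_smul_right, wedge_self,
    wedge_swap (coordVector p 0) (coordVector p 1), wedge_swap (coordVector p 0) (coordVector p 2),
    wedge_swap (coordVector p 0) (coordVector p 3), wedge_swap (coordVector p 1) (coordVector p 2),
    wedge_swap (coordVector p 1) (coordVector p 3), wedge_swap (coordVector p 2) (coordVector p 3)]
  module

/-- The bivector dual to the Kähler form. -/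
noncomputable def kahlerBivector (p : CP2) : Bivector 4 p :=
  wedge (coordVector p 0) (coordVector p 1) + wedge (coordVector p 2) (coordVector p 3)

/-- Each term of the Weyl tensor is a pairing with y ∧ z: the first two form ⟨Jv ∧ Jw, y ∧ z⟩, the
last two ⟨v ∧ w, y ∧ z⟩, and ⟨Jy, z⟩ = ⟨K, y ∧ z⟩ for the Kähler bivector K. In the centred chart
raising indices is trivial, and the factor 1/2 compensates for summing over ordered pairs of
indices. -/
lemma weylOperator_wedge (v w : TangentSpace (𝓡 4) p) :
    weylOperator fubiniStudy p (wedge v w) = wedge (J p v) (J p w) - wedge v w +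
      (2 * fubiniStudy.inner p (J p v) w) • kahlerBivector p := by
  have h1 : weylOperator fubiniStudy p (wedge v w) = weylBilinear fubiniStudy p v w := by
    rw [weylOperator, wedge, exteriorPower.alternatingMapLinearEquiv_apply_ιMulti]
    rfl
  have h2 : weylBilinear fubiniStudy p v w = ∑ k, ∑ l,
      (1 / 2 * weylTensor fubiniStudy p v w (coordVector p k) (coordVector p l)) •
        wedge (coordVector p k) (coordVector p l) := by
    rw [weylBilinear, LinearMap.mk₂_apply, metricInChart_eq_fsMatrix, extChartAt_self,
      fsMatrix_zero, inv_one]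
    refine Finset.sum_congr rfl fun k _ ↦ Finset.sum_congr rfl fun l _ ↦ ?_
    rw [Finset.sum_eq_single k (fun a _ ha ↦ by simp [Matrix.one_apply_ne ha.symm]) (by simp),
      Finset.sum_eq_single l (fun a _ ha ↦ by simp [Matrix.one_apply_ne ha.symm]) (by simp)]
    simp only [Matrix.one_apply_eq]
    congr 1
    ring
  rw [h1, h2]
  simp only [weylTensor_fubiniStudy, fubiniStudy_inner_J_coordVector]
  simp only [fubiniStudy_inner_coordVector, kahlerBivector]
  rw [wedge_eq_sum v w, wedge_eq_sum (J p v) (J p w)]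
  generalize fubiniStudy.inner p (J p v) w = c
  generalize tangentCoord p (J p v) = v'
  generalize tangentCoord p (J p w) = w'
  generalize tangentCoord p v = v
  generalize tangentCoord p w = w
  simp only [Fin.sum_univ_four, wedge_self, omega_eq,
    wedge_swap (coordVector p 0) (coordVector p 1), wedge_swap (coordVector p 0) (coordVector p 2),
    wedge_swap (coordVector p 0) (coordVector p 3), wedge_swap (coordVector p 1) (coordVector p 2),
    wedge_swap (coordVector p 1) (coordVector p 3), wedge_swap (coordVector p 2) (coordVector p 3)]
  simp only [Matrix.of_apply, Matrix.cons_val]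
  module

lemma J_J (v : TangentSpace (𝓡 4) p) : J p (J p v) = -v :=
  complexStructure_complexStructure v

variable {e : Fin 4 → TangentSpace (𝓡 4) p}

/-- Twice either side is the sum of eᵢ ∧ J eᵢ over an orthonormal frame, which depends only on the
sum of eᵢ ⊗ eᵢ. The latter is frame independent: a matrix with orthonormal rows has orthonormal
columns, and these are the relations `hc`. -/
lemma IsAdaptedFrame.kahlerBivector_eq (he : IsAdaptedFrame p e) :
    kahlerBivector p = wedge (e 0) (e 1) + wedge (e 2) (e 3) := by
  obtain ⟨ho, h1, h3⟩ := he
  let P : Matrix (Fin 4) (Fin 4) ℝ := Matrix.of fun i k ↦ tangentCoord p (e i) k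
  have hP : P * P.transpose = 1 := by
    ext i j
    rw [Matrix.mul_apply, Fin.sum_univ_four, Matrix.one_apply, ← ho i j, fubiniStudy_inner,
      inner_coord_eq]
    rfl
  have hP' : P.transpose * P = 1 := mul_eq_one_comm.1 hP
  have hc : ∀ k l, tangentCoord p (e 0) k * tangentCoord p (e 0) l +
      tangentCoord p (e 1) k * tangentCoord p (e 1) l +
      tangentCoord p (e 2) k * tangentCoord p (e 2) l +
      tangentCoord p (e 3) k * tangentCoord p (e 3) l = (1 : Matrix (Fin 4) (Fin 4) ℝ) k l :=
    fun k l ↦ by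
      rw [← hP', Matrix.mul_apply, Fin.sum_univ_four]
      rfl
  rw [wedge_eq_sum (e 0), wedge_eq_sum (e 2), kahlerBivector]
  have c00 := hc 0 0
  have c01 := hc 0 1
  have c02 := hc 0 2
  have c03 := hc 0 3
  have c12 := hc 1 2
  have c13 := hc 1 3
  have c22 := hc 2 2
  have c23 := hc 2 3
  simp only [h1, h3, tangentCoord_J, complexStructure_apply] at c00 c01 c02 c03 c12 c13 c22 c23 ⊢
  generalize tangentCoord p (e 0) = x at *
  generalize tangentCoord p (e 2) = y at *
  simp at c00 c01 c02 c03 c12 c13 c22 c23 ⊢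
  linear_combination (norm := module) -c00 • wedge (coordVector p 0) (coordVector p 1) +
    c03 • wedge (coordVector p 0) (coordVector p 2) -
    c02 • wedge (coordVector p 0) (coordVector p 3) +
    c13 • wedge (coordVector p 1) (coordVector p 2) -
    c12 • wedge (coordVector p 1) (coordVector p 3) -
    c22 • wedge (coordVector p 2) (coordVector p 3)

/-- The map v ∧ w ↦ Jv ∧ Jw fixes K and the anti-self-dual bivectors and is -1 on the other two
self-dual frame elements, where it contributes -2 together with the term -v ∧ w. The remaining term
is σ ↦ 2⟨K, σ⟩K; it vanishes on the orthogonal complement of K and gives 4 on K, since ⟨K, K⟩ = 2.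
-/
lemma IsAdaptedFrame.weylOperator_frame (he : IsAdaptedFrame p e) (i : Fin 3) :
    weylOperator fubiniStudy p (selfDualFrame e i) =
        (![4, -2, -2] : Fin 3 → ℝ) i • selfDualFrame e i ∧
      weylOperator fubiniStudy p (antiSelfDualFrame e i) = 0 := by
  have hk := he.kahlerBivector_eq
  obtain ⟨ho, h1, h3⟩ := he
  have j1 : J p (e 1) = -e 0 := by rw [h1, J_J]
  have j3 : J p (e 3) = -e 2 := by rw [h3, J_J]
  have n : ∀ v w : TangentSpace (𝓡 4) p, wedge (-v) w = -wedge v w := fun v w ↦ by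
    simpa using wedge_smul_left (-1) v w
  constructor <;> fin_cases i <;>
    simp only [selfDualFrame, antiSelfDualFrame, Fin.zero_eta, Fin.mk_one, Fin.reduceFinMk,
      Matrix.cons_val_zero, Matrix.cons_val_one, Matrix.cons_val, map_add, map_sub,
      weylOperator_wedge, hk, ← h1, ← h3, j1, j3, wedge_neg_right, n, neg_neg, ho,
      ContinuousLinearMap.map_neg, neg_apply, Fin.isValue, Fin.reduceEq,
      if_true, if_false, wedge_swap (e 0) (e 1), wedge_swap (e 2) (e 3)] <;>
    module

/-- A quarter turn of `ℂ²` that maps every vector to a vector orthogonal to its complex span. -/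
noncomputable def quaternionic (x : Coord 4) : Coord 4 := !₂[-x 2, x 3, x 0, -x 1]

/-- In complex coordinates `quaternionic` is (z₁, z₂) ↦ (-z̄₂, z̄₁). It completes x to the
orthogonal frame x, Jx, y, Jy of vectors of equal length, which is used for adapted frames, for the
positivity of the form and for the final contradiction. -/
lemma inner_quaternionic_self (x : Coord 4) :
    inner ℝ x (quaternionic x) = 0 ∧ inner ℝ (complexStructure x) (quaternionic x) = 0 ∧
      inner ℝ (quaternionic x) (quaternionic x) = inner ℝ x x := by
  simp only [inner_coord_eq, quaternionic, complexStructure_apply]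
  simp
  refine ⟨?_, ?_, ?_⟩ <;> ring

lemma exists_isAdaptedFrame (v : TangentSpace (𝓡 4) p) (hv : fubiniStudy.inner p v v = 1) :
    ∃ e, IsAdaptedFrame p e ∧ e 0 = v := by
  rw [fubiniStudy_inner] at hv
  set x := tangentCoord p v with hx
  obtain ⟨h1, h2, h3⟩ := inner_quaternionic_self x
  set y := quaternionic x
  let T : Coord 4 → TangentSpace (𝓡 4) p := (tangentCoord p).symm
  refine ⟨![T x, T (complexStructure x), T y, T (complexStructure y)], ⟨?_, rfl, rfl⟩, ?_⟩
  · have h4 : inner ℝ x (complexStructure y) = 0 := by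
      rw [← neg_eq_zero, ← inner_complexStructure_left, h2]
    have h5 := inner_complexStructure_self x
    have h6 := inner_complexStructure_self y
    have h7 : inner ℝ y (complexStructure y) = 0 := by rw [real_inner_comm, h6]
    have n : ∀ z : Coord 4, inner ℝ z z = 1 → ‖z‖ = 1 := fun z hz ↦ by
      rw [norm_eq_sqrt_real_inner, hz, Real.sqrt_one]
    have n1 := n _ hv
    have n2 := n _ ((inner_complexStructure_complexStructure x x).trans hv)
    have n3 := n _ (h3.trans hv)
    have n4 := n _ ((inner_complexStructure_complexStructure y y).trans (h3.trans hv))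
    intro i j
    rw [fubiniStudy_inner]
    fin_cases i <;> fin_cases j <;>
      simp [T, inner_complexStructure_complexStructure, h1, h2, h4, h5, h6, h7, n1, n2, n3, n4,
        real_inner_comm x, real_inner_comm (complexStructure x)]
  · simp [T, hx]

lemma exists_unit (p : CP2) : ∃ v : TangentSpace (𝓡 4) p, fubiniStudy.inner p v v = 1 :=
  ⟨coordVector p 0, by rw [fubiniStudy_inner_coordVector]; simp [coordVector]⟩

/-- The Weyl operator of the Fubini-Study metric does not satisfy the eigenflag condition. -/
lemma not_eigenflag (p : CP2) : ¬ Eigenflag fubiniStudy p (weylOperator fubiniStudy p) := by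
  rintro ⟨v, hv, h⟩
  have hpos : 0 < fubiniStudy.inner p v v := fubiniStudy.pos p v hv
  set r := Real.sqrt (fubiniStudy.inner p v v) with hr
  have hr0 : 0 < r := Real.sqrt_pos.2 hpos
  have hr2 : r * r = fubiniStudy.inner p v v := Real.mul_self_sqrt hpos.le
  obtain ⟨e, he, he0⟩ := exists_isAdaptedFrame (r⁻¹ • v) (by
    simp only [map_smul, smul_apply, smul_eq_mul, ← hr2]
    field_simp)
  have hv' : v = r • e 0 := by rw [he0, smul_inv_smul₀ hr0.ne']
  have hk := he.kahlerBivector_eq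
  obtain ⟨ho, h1, h3⟩ := he
  -- The test vector is e₂ = J e₁, the direction of Jv: then W(v ∧ e₂) is a nonzero multiple of K
  -- and has an e₃ ∧ e₄ component, whereas v ∧ w' has none.
  obtain ⟨w', -, hw⟩ := h (e 1) (by simp [hv', ho])
  have j1 : J p (e 1) = -e 0 := by rw [h1, J_J]
  have h5 := congrArg (fun σ ↦ bivectorInner fubiniStudy p σ (wedge (e 2) (e 3))) hw
  simp only [hv', wedge_smul_left, map_smul, weylOperator_wedge, hk, map_add, map_sub,
    LinearMap.add_apply, LinearMap.sub_apply, LinearMap.smul_apply, bivectorInner_wedge, ← h1,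
    j1, ho] at h5
  simp [ho] at h5
  exact hr0.ne' h5

end CP2

/-! ### From the Poisson bracket to a condition on the Hessian. -/

section CarlemanSymbol

open Matrix

/-- The vectors u and w are ξ and η with raised indices. Since the inverse has derivative -G⁻¹ G'
G⁻¹, the formula involves derivatives of G only. It serves both the base derivatives of the symbol
and, with G constant, the fibre derivatives. -/
lemma hasFDerivAt_sum_inv_mul {E : Type*} [NormedAddCommGroup E] [NormedSpace ℝ E] {n : ℕ}
    {G : E → Matrix (Fin n) (Fin n) ℝ} {G' : Fin n → Fin n → E →L[ℝ] ℝ} {x : E}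
    {ξ η : E → Fin n → ℝ} {ξ' η' : Fin n → E →L[ℝ] ℝ} (hdet : (G x).det ≠ 0)
    (hG : ∀ i j, HasFDerivAt (fun y ↦ G y i j) (G' i j) x)
    (hξ : ∀ i, HasFDerivAt (fun y ↦ ξ y i) (ξ' i) x)
    (hη : ∀ i, HasFDerivAt (fun y ↦ η y i) (η' i) x) {u w : Fin n → ℝ}
    (hu : ξ x ᵥ* (G x)⁻¹ = u) (hw : (G x)⁻¹ *ᵥ η x = w) :
    HasFDerivAt (fun y ↦ ∑ j, ∑ k, (G y)⁻¹ j k * (ξ y j * η y k))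
      (∑ j, w j • ξ' j + ∑ k, u k • η' k - ∑ i, ∑ j, (u i * w j) • G' i j) x := by
  have hK : ∀ i j, HasFDerivAt (fun y ↦ (G y)⁻¹ i j) (fderiv ℝ (fun y ↦ (G y)⁻¹ i j) x) x :=
    fun i j ↦ (DifferentiableAt.matrix_inv_apply (fun i j ↦ (hG i j).differentiableAt) hdet
      i j).hasFDerivAt
  set D : Fin n → Fin n → E →L[ℝ] ℝ := fun i j ↦ fderiv ℝ (fun y ↦ (G y)⁻¹ i j) x
  have hnear : ∀ᶠ y in nhds x, (G y).det ≠ 0 :=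
    (DifferentiableAt.matrix_det fun i j ↦ (hG i j).differentiableAt).continuousAt.eventually_ne hdet
  have hD : ∀ h : E, (Matrix.of fun i j ↦ D i j h) =
      -((G x)⁻¹ * (Matrix.of fun i j ↦ G' i j h) * (G x)⁻¹) := by
    intro h
    -- This is the derivative of G⁻¹ G = 1, an identity valid near x because the determinant stays
    -- nonzero.
    have h0 : (Matrix.of fun i j ↦ D i j h) * G x +
        (G x)⁻¹ * (Matrix.of fun i j ↦ G' i j h) = 0 := by
      ext j l
      have h1 : HasFDerivAt (fun y ↦ ∑ k, (G y)⁻¹ j k * G y k l) (0 : E →L[ℝ] ℝ) x := by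
        refine (hasFDerivAt_const ((1 : Matrix (Fin n) (Fin n) ℝ) j l) x).congr_of_eventuallyEq ?_
        filter_upwards [hnear] with y hy
        rw [← Matrix.mul_apply, Matrix.nonsing_inv_mul _ (isUnit_iff_ne_zero.2 hy)]
      have h2 := HasFDerivAt.fun_sum (u := Finset.univ) fun k _ ↦ (hK j k).mul (hG k l)
      have h3 := DFunLike.congr_fun (h2.unique h1) h
      simp only [_root_.sum_apply, _root_.add_apply, _root_.smul_apply,
        smul_eq_mul, _root_.zero_apply, Finset.sum_add_distrib] at h3
      simp only [Matrix.add_apply, Matrix.mul_apply, Matrix.of_apply, Matrix.zero_apply]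
      rw [← h3, add_comm]
      congr 1
      exact Finset.sum_congr rfl fun k _ ↦ mul_comm _ _
    have h4 := congrArg (· * (G x)⁻¹) h0
    simp only [add_mul, zero_mul] at h4
    rw [Matrix.mul_assoc, Matrix.mul_nonsing_inv _ (isUnit_iff_ne_zero.2 hdet), Matrix.mul_one] at h4
    exact eq_neg_of_add_eq_zero_left h4
  have hF := HasFDerivAt.fun_sum (u := Finset.univ) fun j _ ↦
    HasFDerivAt.fun_sum (u := Finset.univ) fun k _ ↦ (hK j k).mul ((hξ j).mul (hη k))
  refine hF.congr_fderiv ?_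
  ext h
  have e1 : ∑ j, ∑ k, ξ x j * η x k * D j k h = -∑ i, ∑ j, u i * w j * G' i j h := by
    have e2 : ξ x ⬝ᵥ ((Matrix.of fun i j ↦ D i j h) *ᵥ η x) =
        -(u ⬝ᵥ ((Matrix.of fun i j ↦ G' i j h) *ᵥ w)) := by
      rw [hD h, ← hu, ← hw, Matrix.neg_mulVec, dotProduct_neg, ← Matrix.mulVec_mulVec,
        ← Matrix.mulVec_mulVec, Matrix.dotProduct_mulVec]
    simp only [dotProduct, Matrix.mulVec, Matrix.of_apply, Finset.mul_sum] at e2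
    refine Eq.trans ?_ (e2.trans ?_)
    · exact Finset.sum_congr rfl fun i _ ↦ Finset.sum_congr rfl fun j _ ↦ by ring
    · exact congrArg _ (Finset.sum_congr rfl fun i _ ↦ Finset.sum_congr rfl fun j _ ↦ by ring)
  have e3 : ∑ j, ∑ k, (G x)⁻¹ j k * (η x k * ξ' j h) = ∑ j, w j * ξ' j h := by
    refine Finset.sum_congr rfl fun j _ ↦ ?_
    rw [← hw, Matrix.mulVec, dotProduct, Finset.sum_mul]
    exact Finset.sum_congr rfl fun k _ ↦ by ring
  have e4 : ∑ j, ∑ k, (G x)⁻¹ j k * (ξ x j * η' k h) = ∑ k, u k * η' k h := by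
    rw [Finset.sum_comm]
    refine Finset.sum_congr rfl fun k _ ↦ ?_
    rw [← hu, Matrix.vecMul, dotProduct, Finset.sum_mul]
    exact Finset.sum_congr rfl fun j _ ↦ by ring
  simp only [_root_.sum_apply, _root_.add_apply, _root_.smul_apply,
    _root_.sub_apply, smul_eq_mul, mul_add, Finset.sum_add_distrib, Pi.mul_apply]
  simp only [D] at e1
  rw [e1, e3, e4]
  ring

lemma fderiv_ofReal_add_two_I_mul {E : Type*} [NormedAddCommGroup E] [NormedSpace ℝ E]
    {a b : E → ℝ} {a' b' : E →L[ℝ] ℝ} {x : E} (ha : HasFDerivAt a a' x) (hb : HasFDerivAt b b' x)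
    (h : E) : fderiv ℝ (fun y ↦ (a y : ℂ) + 2 * Complex.I * (b y : ℂ)) x h =
      (a' h : ℂ) + 2 * Complex.I * (b' h : ℂ) ∧
    fderiv ℝ (fun y ↦ starRingEnd ℂ ((a y : ℂ) + 2 * Complex.I * (b y : ℂ))) x h =
      (a' h : ℂ) - 2 * Complex.I * (b' h : ℂ) := by
  have h1 := (Complex.ofRealCLM.hasFDerivAt.comp x ha).add
    ((Complex.ofRealCLM.hasFDerivAt.comp x hb).const_mul (2 * Complex.I))
  have h2 := (Complex.conjCLE.toContinuousLinearMap.hasFDerivAt.comp x h1)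
  constructor
  · rw [HasFDerivAt.fderiv (f := fun y ↦ (a y : ℂ) + 2 * Complex.I * (b y : ℂ)) h1]
    simp
  · rw [HasFDerivAt.fderiv
      (f := fun y ↦ starRingEnd ℂ ((a y : ℂ) + 2 * Complex.I * (b y : ℂ))) h2]
    simp [map_ofNat (starRingEnd ℂ) 2]
    ring

variable {n : ℕ}

/-- The Hessian of `φ` for the metric `B`, as a quadratic form in `v`, where `X` is the gradient. -/
noncomputable def hessForm (B : Coord n → Coord n →L[ℝ] Coord n →L[ℝ] ℝ) (φ : Coord n → ℝ)
    (x v X : Coord n) : ℝ :=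
  fderiv ℝ (fderiv ℝ φ) x v v - fderiv ℝ B x v v X + 1 / 2 * fderiv ℝ B x X v v

/-- The condition on the Hessian of a limiting Carleman weight: `Hess φ(v, v) = -Hess φ(∇φ, ∇φ)`
whenever `v` is orthogonal to `∇φ` and of the same length. -/
def HessCondition (B : Coord n → Coord n →L[ℝ] Coord n →L[ℝ] ℝ) (φ : Coord n → ℝ)
    (x : Coord n) : Prop :=
  ∀ X, (∀ w, B x X w = fderiv ℝ φ x w) → ∀ v, fderiv ℝ φ x v = 0 → B x v v = B x X X →
    hessForm B φ x v X + hessForm B φ x X X = 0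

lemma coord_eq_sum (v : Coord n) : v = ∑ i, v i • EuclideanSpace.single i (1 : ℝ) := by
  conv_lhs => rw [← (EuclideanSpace.basisFun (Fin n) ℝ).sum_repr v]
  simp

lemma clm_apply_eq_sum {F : Type*} [NormedAddCommGroup F] [NormedSpace ℝ F]
    (L : Coord n →L[ℝ] F) (v : Coord n) : L v = ∑ i, v i • L (EuclideanSpace.single i 1) := by
  conv_lhs => rw [coord_eq_sum v]
  simp only [map_sum, map_smul]

lemma bilin_apply_eq_sum (L : Coord n →L[ℝ] Coord n →L[ℝ] ℝ) (v w : Coord n) :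
    L v w = ∑ i, ∑ j, v i * w j * L (EuclideanSpace.single i 1) (EuclideanSpace.single j 1) := by
  rw [clm_apply_eq_sum L v, _root_.sum_apply]
  refine Finset.sum_congr rfl fun i _ ↦ ?_
  rw [_root_.smul_apply, clm_apply_eq_sum _ w, smul_eq_mul, Finset.mul_sum]
  exact Finset.sum_congr rfl fun j _ ↦ by rw [smul_eq_mul]; ring

/-- Write the symbol as p = a + 2ib, so that {p̄, p} = 4i{a, b}. The covector dual to a vector v
orthogonal to X = ∇φ and of the same length is a zero of both a and b, and there {a, b} = 2(Hess
φ(v, v) + Hess φ(X, X)). In `hessForm` the two metric terms are the Christoffel correction paired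
with X, so that no inverse metric occurs. -/
lemma hessCondition_of_poissonBracket {G : Coord n → Matrix (Fin n) (Fin n) ℝ}
    {B : Coord n → Coord n →L[ℝ] Coord n →L[ℝ] ℝ} {φ : Coord n → ℝ} {x : Coord n}
    (hG : ∀ᶠ y in nhds x, G y = Matrix.of fun i j ↦
      B y (EuclideanSpace.single i 1) (EuclideanSpace.single j 1))
    (hB : DifferentiableAt ℝ B x) (hsymm : ∀ v w, B x v w = B x w v)
    (hpos : ∀ v, v ≠ 0 → 0 < B x v v) (hφ : ContDiffAt ℝ 2 φ x)
    (h : ∀ ξ : Coord n, carlemanSymbol G φ x ξ = 0 →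
      poissonBracket (fun x η ↦ starRingEnd ℂ (carlemanSymbol G φ x η)) (carlemanSymbol G φ) x ξ = 0) :
    HessCondition B φ x := by
  intro X hX v hv hvX
  set ε : Fin n → Coord n := fun i ↦ EuclideanSpace.single i 1 with hε
  have hGx : ∀ i j, G x i j = B x (ε i) (ε j) := fun i j ↦ by rw [hG.self_of_nhds]; rfl
  have hGv : ∀ z : Coord n, G x *ᵥ (z : Fin n → ℝ) = fun i ↦ B x z (ε i) := by
    intro z
    ext i
    rw [hsymm, clm_apply_eq_sum _ z]
    simp only [Matrix.mulVec, dotProduct, hGx, smul_eq_mul]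
    exact Finset.sum_congr rfl fun j _ ↦ mul_comm _ _
  have hdet : (G x).det ≠ 0 := by
    intro h0
    obtain ⟨z, hz, hz0⟩ := Matrix.exists_mulVec_eq_zero_iff.2 h0
    have h1 : WithLp.toLp 2 z ≠ (0 : Coord n) := fun h ↦ hz (by simpa using h)
    refine (hpos _ h1).ne' ?_
    have h2 := hGv (WithLp.toLp 2 z)
    rw [show G x *ᵥ ((WithLp.toLp 2 z : Coord n) : Fin n → ℝ) = 0 from hz0] at h2
    rw [clm_apply_eq_sum]
    exact Finset.sum_eq_zero fun i _ ↦ by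
      rw [← congrFun h2 i, Pi.zero_apply, smul_zero]
  have hGt : (G x)ᵀ = G x := by
    ext i j
    rw [Matrix.transpose_apply, hGx, hGx, hsymm]
  have hKt : ((G x)⁻¹)ᵀ = (G x)⁻¹ := by rw [Matrix.transpose_nonsing_inv, hGt]
  have hK : ∀ z : Coord n, (G x)⁻¹ *ᵥ (fun i ↦ B x z (ε i)) = z := fun z ↦ by
    rw [← hGv, Matrix.mulVec_mulVec, Matrix.nonsing_inv_mul _ (isUnit_iff_ne_zero.2 hdet),
      Matrix.one_mulVec]
  have hK' : ∀ z : Coord n, (fun i ↦ B x z (ε i)) ᵥ* (G x)⁻¹ = z := fun z ↦ by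
    rw [← hKt, Matrix.vecMul_transpose, hK]
  have hBij : ∀ i j, HasFDerivAt (fun y ↦ B y (ε i) (ε j))
      ((((ContinuousLinearMap.apply ℝ ℝ (ε j)).comp
        (ContinuousLinearMap.apply ℝ (Coord n →L[ℝ] ℝ) (ε i))).comp (fderiv ℝ B x))) x := by
    intro i j
    exact ((ContinuousLinearMap.apply ℝ ℝ (ε j)).comp
        (ContinuousLinearMap.apply ℝ (Coord n →L[ℝ] ℝ) (ε i))).hasFDerivAt.comp x hB.hasFDerivAt
  have hGij : ∀ i j, HasFDerivAt (fun y ↦ G y i j)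
      ((((ContinuousLinearMap.apply ℝ ℝ (ε j)).comp
        (ContinuousLinearMap.apply ℝ (Coord n →L[ℝ] ℝ) (ε i))).comp (fderiv ℝ B x))) x := by
    intro i j
    refine (hBij i j).congr_of_eventuallyEq ?_
    filter_upwards [hG] with y hy
    rw [hy]
    rfl
  have hd2 : DifferentiableAt ℝ (fderiv ℝ φ) x :=
    (hφ.fderiv_right (m := 1) (by norm_num)).differentiableAt (by norm_num)
  have hφj : ∀ j, HasFDerivAt (fun y ↦ pderiv j φ y)
      ((ContinuousLinearMap.apply ℝ ℝ (ε j)).comp (fderiv ℝ (fderiv ℝ φ) x)) x := fun j ↦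
    (ContinuousLinearMap.apply ℝ ℝ (ε j)).hasFDerivAt.comp x hd2.hasFDerivAt
  have hdφ : (fun j ↦ pderiv j φ x) = fun j ↦ B x X (ε j) := by
    ext j
    rw [hX]
    rfl
  set ξ : Coord n := WithLp.toLp 2 fun i ↦ B x v (ε i) with hξ
  have hξc : ∀ i, HasFDerivAt (fun _ : Coord n ↦ ξ i) (0 : Coord n →L[ℝ] ℝ) x := fun i ↦
    hasFDerivAt_const _ _
  have hproj : ∀ i, HasFDerivAt (fun η : Coord n ↦ η i) (EuclideanSpace.proj (𝕜 := ℝ) i) ξ :=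
    fun i ↦ (EuclideanSpace.proj (𝕜 := ℝ) i : Coord n →L[ℝ] ℝ).hasFDerivAt
  have hGc : ∀ i j, HasFDerivAt (fun _ : Coord n ↦ G x i j) (0 : Coord n →L[ℝ] ℝ) ξ := fun i j ↦
    hasFDerivAt_const _ _
  have hφc : ∀ i, HasFDerivAt (fun _ : Coord n ↦ pderiv i φ x) (0 : Coord n →L[ℝ] ℝ) ξ := fun i ↦
    hasFDerivAt_const _ _
  have hXK : (G x)⁻¹ *ᵥ (fun j ↦ pderiv j φ x) = X := by rw [hdφ, hK]
  have hXK' : (fun j ↦ pderiv j φ x) ᵥ* (G x)⁻¹ = X := by rw [hdφ, hK']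
  let a : Coord n → Coord n → ℝ := fun y η ↦
    ∑ j, ∑ k, (G y)⁻¹ j k * (η j * η k) -
      ∑ j, ∑ k, (G y)⁻¹ j k * (pderiv j φ y * pderiv k φ y)
  let b : Coord n → Coord n → ℝ := fun y η ↦ ∑ j, ∑ k, (G y)⁻¹ j k * (η j * pderiv k φ y)
  have hsym : carlemanSymbol G φ = fun y η ↦ (a y η : ℂ) + 2 * Complex.I * (b y η : ℂ) := by
    funext y η
    simp only [carlemanSymbol, a, b, mul_sub, Finset.sum_sub_distrib]
  -- derivatives of the symbol in the fibre
  obtain ⟨aη, haη, haη'⟩ : ∃ L, HasFDerivAt (fun η ↦ a x η) L ξ ∧ ∀ m, L (ε m) = 2 * v m := by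
    refine ⟨_, (hasFDerivAt_sum_inv_mul (G := fun _ ↦ G x) hdet hGc hproj hproj
      (hK' v) (hK v)).sub (hasFDerivAt_sum_inv_mul (G := fun _ ↦ G x) (x := ξ) hdet hGc hφc hφc
      (ξ := fun _ j ↦ pderiv j φ x) (η := fun _ j ↦ pderiv j φ x) hXK' hXK), fun m ↦ ?_⟩
    simp [hε, two_mul]
  obtain ⟨bη, hbη, hbη'⟩ : ∃ L, HasFDerivAt (fun η ↦ b x η) L ξ ∧ ∀ m, L (ε m) = X m := by
    refine ⟨_, hasFDerivAt_sum_inv_mul (G := fun _ ↦ G x) (x := ξ) hdet hGc hproj hφc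
      (η := fun _ j ↦ pderiv j φ x) (hK' v) hXK, fun m ↦ ?_⟩
    simp [hε]
  -- derivatives of the symbol in the base
  obtain ⟨ax, hax, hax'⟩ : ∃ L, HasFDerivAt (fun y ↦ a y ξ) L x ∧ ∀ h, L h =
      -fderiv ℝ B x h v v - 2 * fderiv ℝ (fderiv ℝ φ) x h X + fderiv ℝ B x h X X := by
    refine ⟨_, (hasFDerivAt_sum_inv_mul (ξ := fun _ j ↦ ξ j) (η := fun _ j ↦ ξ j) hdet hGij hξc hξc
      (hK' v) (hK v)).sub (hasFDerivAt_sum_inv_mul (ξ := fun y j ↦ pderiv j φ y)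
      (η := fun y j ↦ pderiv j φ y) hdet hGij hφj hφj hXK' hXK), fun h ↦ ?_⟩
    rw [bilin_apply_eq_sum _ v v, bilin_apply_eq_sum _ X X, clm_apply_eq_sum _ X]
    simp [ε]
    ring
  obtain ⟨bx, hbx, hbx'⟩ : ∃ L, HasFDerivAt (fun y ↦ b y ξ) L x ∧ ∀ h, L h =
      fderiv ℝ (fderiv ℝ φ) x h v - fderiv ℝ B x h v X := by
    refine ⟨_, hasFDerivAt_sum_inv_mul (ξ := fun _ j ↦ ξ j)
      (η := fun y j ↦ pderiv j φ y) hdet hGij hξc hφj (hK' v) hXK, fun h ↦ ?_⟩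
    rw [bilin_apply_eq_sum _ v X, clm_apply_eq_sum _ v]
    simp [ε]
  have hmem : carlemanSymbol G φ x ξ = 0 := by
    have e1 : ∀ η ζ : Fin n → ℝ, ∑ j, ∑ k, (G x)⁻¹ j k * (η j * ζ k) = η ⬝ᵥ ((G x)⁻¹ *ᵥ ζ) :=
      fun η ζ ↦ by
        simp only [dotProduct, Matrix.mulVec, Finset.mul_sum]
        exact Finset.sum_congr rfl fun j _ ↦ Finset.sum_congr rfl fun k _ ↦ by ring
    have e2 : ∀ z z' : Coord n, (fun i ↦ B x z (ε i)) ⬝ᵥ (z' : Fin n → ℝ) = B x z z' := by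
      intro z z'
      rw [clm_apply_eq_sum _ z']
      exact Finset.sum_congr rfl fun i _ ↦ mul_comm _ _
    have ha : a x ξ = 0 := by
      have h1 := e1 (fun j ↦ ξ j) (fun j ↦ ξ j)
      have h2 := e1 (fun j ↦ pderiv j φ x) (fun j ↦ pderiv j φ x)
      simp only [a]
      rw [h1, h2, hXK, hdφ, hK v, e2, e2, hvX, sub_self]
    have hb : b x ξ = 0 := by
      have h1 := e1 (fun j ↦ ξ j) (fun j ↦ pderiv j φ x)
      simp only [b]
      rw [h1, hXK, e2, hsymm, hX, hv]
    rw [hsym]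
    simp [ha, hb]
  have hbr := h ξ hmem
  simp only [hsym, poissonBracket] at hbr
  have f1 := fun m ↦ fderiv_ofReal_add_two_I_mul haη hbη (ε m)
  have f2 := fun m ↦ fderiv_ofReal_add_two_I_mul hax hbx (ε m)
  have hsum : ∑ m, 4 * Complex.I *
      ((v m * (2 * bx (ε m)) - X m * ax (ε m) : ℝ) : ℂ) = 0 := by
    rw [← hbr]
    refine Finset.sum_congr rfl fun m _ ↦ ?_
    rw [(f1 m).1, (f1 m).2, (f2 m).1, (f2 m).2, haη', hbη']
    push_cast
    ring
  rw [← Finset.mul_sum, ← Complex.ofReal_sum] at hsum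
  have hsum' : ∑ m, (v m * (2 * bx (ε m)) - X m * ax (ε m)) = 0 := by
    have := (mul_eq_zero.1 hsum).resolve_left (by simp)
    exact_mod_cast this
  have hv2 := clm_apply_eq_sum bx v
  have hX2 := clm_apply_eq_sum ax X
  rw [hbx'] at hv2
  rw [hax'] at hX2
  have e : ∑ m, (v m * (2 * bx (ε m)) - X m * ax (ε m)) =
      2 * ∑ m, v m • bx (ε m) - ∑ m, X m • ax (ε m) := by
    rw [Finset.sum_sub_distrib, Finset.mul_sum]
    congr 1
    exact Finset.sum_congr rfl fun m _ ↦ by rw [smul_eq_mul]; ring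
  rw [hsum', ← hv2, ← hX2] at e
  unfold hessForm
  linarith

end CarlemanSymbol

/-! ### Invariance of the Hessian condition under changes of coordinates. -/

section Pullback

variable {n : ℕ}

/-- The pullback of a field of bilinear forms. -/
noncomputable def pullbackForm (B : Coord n → Coord n →L[ℝ] Coord n →L[ℝ] ℝ)
    (Ψ : Coord n → Coord n) (x : Coord n) : Coord n →L[ℝ] Coord n →L[ℝ] ℝ :=
  ((((B (Ψ x)).comp (fderiv ℝ Ψ x)).flip).comp (fderiv ℝ Ψ x)).flip

lemma pullbackForm_apply (B : Coord n → Coord n →L[ℝ] Coord n →L[ℝ] ℝ) (Ψ : Coord n → Coord n)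
    (x v w : Coord n) :
    pullbackForm B Ψ x v w = B (Ψ x) (fderiv ℝ Ψ x v) (fderiv ℝ Ψ x w) := rfl

variable {B : Coord n → Coord n →L[ℝ] Coord n →L[ℝ] ℝ} {φ : Coord n → ℝ} {Ψ : Coord n → Coord n}
  {x : Coord n}

lemma HessCondition.congr {φ' : Coord n → ℝ} (h : HessCondition B φ x) (he : φ =ᶠ[nhds x] φ') :
    HessCondition B φ' x := by
  have h1 := he.fderiv_eq (𝕜 := ℝ)
  have h2 := (he.fderiv (𝕜 := ℝ)).fderiv_eq (𝕜 := ℝ)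
  unfold HessCondition hessForm at h ⊢
  rwa [h1, h2] at h

lemma ContDiffAt.differentiableAt_fderiv {E F : Type*} [NormedAddCommGroup E] [NormedSpace ℝ E]
    [NormedAddCommGroup F] [NormedSpace ℝ F] {f : E → F} {x : E} (hf : ContDiffAt ℝ 2 f x) :
    DifferentiableAt ℝ (fderiv ℝ f) x :=
  (hf.fderiv_right (m := 1) (by norm_num)).differentiableAt (by norm_num)

lemma differentiableAt_pullbackForm (hΨ : ContDiffAt ℝ 2 Ψ x) (hB : DifferentiableAt ℝ B (Ψ x)) :
    DifferentiableAt ℝ (pullbackForm B Ψ) x := by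
  have hA := hΨ.differentiableAt_fderiv
  have hBΨ : DifferentiableAt ℝ (fun y ↦ B (Ψ y)) x :=
    hB.comp x (hΨ.differentiableAt (by norm_num))
  have hf : Differentiable ℝ (fun L : Coord n →L[ℝ] Coord n →L[ℝ] ℝ ↦ L.flip) :=
    (ContinuousLinearMap.flipₗᵢ ℝ (Coord n) (Coord n) ℝ).toContinuousLinearEquiv.differentiable
  exact (hf _).comp x (((hf _).comp x (hBΨ.clm_comp hA)).clm_comp hA)

lemma fderiv_pullbackForm (hΨ : ContDiffAt ℝ 2 Ψ x) (hB : DifferentiableAt ℝ B (Ψ x))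
    (a v w : Coord n) :
    fderiv ℝ (pullbackForm B Ψ) x a v w =
      fderiv ℝ B (Ψ x) (fderiv ℝ Ψ x a) (fderiv ℝ Ψ x v) (fderiv ℝ Ψ x w) +
      B (Ψ x) (fderiv ℝ (fderiv ℝ Ψ) x a v) (fderiv ℝ Ψ x w) +
      B (Ψ x) (fderiv ℝ Ψ x v) (fderiv ℝ (fderiv ℝ Ψ) x a w) := by
  have hA := hΨ.differentiableAt_fderiv.hasFDerivAt
  have hBΨ : HasFDerivAt (fun y ↦ B (Ψ y)) ((fderiv ℝ B (Ψ x)).comp (fderiv ℝ Ψ x)) x :=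
    hB.hasFDerivAt.comp x (hΨ.differentiableAt (by norm_num)).hasFDerivAt
  have hv := hA.clm_apply (hasFDerivAt_const v x)
  have hw := hA.clm_apply (hasFDerivAt_const w x)
  have h1 := (hBΨ.clm_apply hv).clm_apply hw
  have h2 := ((differentiableAt_pullbackForm hΨ hB).hasFDerivAt.clm_apply
    (hasFDerivAt_const v x)).clm_apply (hasFDerivAt_const w x)
  have h3 := DFunLike.congr_fun (h2.unique h1) a
  simp at h3
  linarith

lemma fderiv_fderiv_comp (hΨ : ContDiffAt ℝ 2 Ψ x) (hφ : ContDiffAt ℝ 2 φ (Ψ x))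
    (a b : Coord n) :
    fderiv ℝ (fderiv ℝ (φ ∘ Ψ)) x a b =
      fderiv ℝ (fderiv ℝ φ) (Ψ x) (fderiv ℝ Ψ x a) (fderiv ℝ Ψ x b) +
      fderiv ℝ φ (Ψ x) (fderiv ℝ (fderiv ℝ Ψ) x a b) := by
  have hA := hΨ.differentiableAt_fderiv.hasFDerivAt
  have hc : ∀ᶠ y in nhds x, fderiv ℝ (φ ∘ Ψ) y = (fderiv ℝ φ (Ψ y)).comp (fderiv ℝ Ψ y) := by
    filter_upwards [hΨ.eventually (by simp), hΨ.continuousAt.eventually (hφ.eventually (by simp))]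
      with y hy hy'
    exact fderiv_comp y (hy'.differentiableAt (by norm_num)) (hy.differentiableAt (by norm_num))
  have hd : HasFDerivAt (fun y ↦ fderiv ℝ φ (Ψ y))
      ((fderiv ℝ (fderiv ℝ φ) (Ψ x)).comp (fderiv ℝ Ψ x)) x :=
    hφ.differentiableAt_fderiv.hasFDerivAt.comp x (hΨ.differentiableAt (by norm_num)).hasFDerivAt
  have h1 := (hd.clm_comp hA).clm_apply (hasFDerivAt_const b x)
  have h2 := ((hd.clm_comp hA).congr_of_eventuallyEq hc).fderiv
  rw [h2]
  simp [add_comm]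

/-- The second derivative of Ψ enters through the chain rule for φ ∘ Ψ and through the derivatives
of the pulled-back form. As dφ is the form paired with dΨ(X), these contributions cancel, by the
symmetry of the second derivative of Ψ and of the form. -/
lemma hessForm_pullback (hΨ : ContDiffAt ℝ 2 Ψ x) (hB : DifferentiableAt ℝ B (Ψ x))
    (hsymm : ∀ v w, B (Ψ x) v w = B (Ψ x) w v) (hφ : ContDiffAt ℝ 2 φ (Ψ x)) (v X : Coord n)
    (hX : ∀ w, B (Ψ x) (fderiv ℝ Ψ x X) w = fderiv ℝ φ (Ψ x) w) :
    hessForm (pullbackForm B Ψ) (φ ∘ Ψ) x v X =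
      hessForm B φ (Ψ x) (fderiv ℝ Ψ x v) (fderiv ℝ Ψ x X) := by
  have hs : fderiv ℝ (fderiv ℝ Ψ) x X v = fderiv ℝ (fderiv ℝ Ψ) x v X :=
    hΨ.isSymmSndFDerivAt (by simp) X v
  rw [hessForm, hessForm, fderiv_fderiv_comp hΨ hφ, fderiv_pullbackForm hΨ hB,
    fderiv_pullbackForm hΨ hB, ← hX, hs, hsymm (fderiv ℝ (fderiv ℝ Ψ) x v v),
    hsymm (fderiv ℝ (fderiv ℝ Ψ) x v X)]
  ring

/-- Surjectivity of dΨ lifts both the gradient and the test vector to the source, where the lifted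
gradient is a gradient of φ ∘ Ψ for the pulled-back form. -/
lemma hessCondition_of_pullback (hΨ : ContDiffAt ℝ 2 Ψ x)
    (hs : Function.Surjective (fderiv ℝ Ψ x)) (hB : DifferentiableAt ℝ B (Ψ x))
    (hsymm : ∀ v w, B (Ψ x) v w = B (Ψ x) w v) (hφ : ContDiffAt ℝ 2 φ (Ψ x))
    (h : HessCondition (pullbackForm B Ψ) (φ ∘ Ψ) x) : HessCondition B φ (Ψ x) := by
  intro X hX v hv hvX
  obtain ⟨X, rfl⟩ := hs X
  obtain ⟨v, rfl⟩ := hs v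
  have hd : ∀ w, fderiv ℝ (φ ∘ Ψ) x w = fderiv ℝ φ (Ψ x) (fderiv ℝ Ψ x w) := fun w ↦ by
    rw [fderiv_comp x (hφ.differentiableAt (by norm_num)) (hΨ.differentiableAt (by norm_num))]
    rfl
  rw [← hessForm_pullback hΨ hB hsymm hφ v X hX, ← hessForm_pullback hΨ hB hsymm hφ X X hX]
  exact h X (fun w ↦ by rw [pullbackForm_apply, hX, hd]) v (by rw [hd, hv]) hvX

end Pullback

/-! ### Umbilicity and the Codazzi obstruction in CP². -/

namespace CP2

lemma fsForm_symm (x v w : Coord 4) : fsForm x v w = fsForm x w v := by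
  rw [fsForm_apply, fsForm_apply, real_inner_comm v w]
  ring

/-- The identity `h` is Parseval in the orthogonal frame x, Jx, y, Jy with y = `quaternionic x`. It
shows that the subtracted squares are dominated by |x|²|v|². -/
lemma fsForm_pos (x v : Coord 4) (hv : v ≠ 0) : 0 < fsForm x v v := by
  have h : ‖x‖ ^ 2 * ‖v‖ ^ 2 = inner ℝ x v ^ 2 + inner ℝ (complexStructure x) v ^ 2 +
      inner ℝ (quaternionic x) v ^ 2 + inner ℝ (complexStructure (quaternionic x)) v ^ 2 := by
    rw [← real_inner_self_eq_norm_sq, ← real_inner_self_eq_norm_sq]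
    simp only [inner_complexStructure_eq]
    simp only [inner_coord_eq, quaternionic]
    simp
    ring
  have hv' : 0 < ‖v‖ ^ 2 := by positivity
  rw [fsForm_apply, real_inner_self_eq_norm_sq]
  have hs : 0 < 1 + ‖x‖ ^ 2 := by positivity
  have : ‖v‖ ^ 2 / (1 + ‖x‖ ^ 2) - (inner ℝ x v * inner ℝ x v +
      inner ℝ (complexStructure x) v * inner ℝ (complexStructure x) v) / (1 + ‖x‖ ^ 2) ^ 2 =
      (‖v‖ ^ 2 + inner ℝ (quaternionic x) v ^ 2 +
        inner ℝ (complexStructure (quaternionic x)) v ^ 2) / (1 + ‖x‖ ^ 2) ^ 2 := by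
    field_simp
    linear_combination h
  rw [this]
  positivity

/-- The gradient for the Fubini-Study metric of a function with Euclidean gradient `n` at `x`. -/
noncomputable def fsGradient (x n : Coord 4) : Coord 4 :=
  (1 + ‖x‖ ^ 2) • (n + inner ℝ x n • x + inner ℝ (complexStructure x) n • complexStructure x)

/-- The explicit gradient makes its continuity along a curve evident, which `third_derivative_eq`
needs. -/
lemma fsForm_fsGradient (x n w : Coord 4) : fsForm x (fsGradient x n) w = inner ℝ n w := by
  have h1 := inner_complexStructure_self x
  have h2 : inner ℝ x (complexStructure x) = 0 := by rw [real_inner_comm, h1]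
  have h3 := inner_complexStructure_complexStructure x x
  have hs : 1 + ‖x‖ ^ 2 ≠ 0 := by positivity
  rw [real_inner_self_eq_norm_sq] at h3
  rw [fsForm_apply]
  simp only [fsGradient, inner_smul_left, inner_smul_right, inner_add_left, inner_add_right, h1, h2,
    h3, real_inner_self_eq_norm_sq, conj_trivial]
  field_simp
  ring

/-- The symmetric bilinear form associated to `hessForm fsForm φ x · X`. -/
noncomputable def fsHessBilin (φ : Coord 4 → ℝ) (x X v w : Coord 4) : ℝ :=
  fderiv ℝ (fderiv ℝ φ) x v w - 1 / 2 * fderiv ℝ fsForm x v w X -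
    1 / 2 * fderiv ℝ fsForm x w v X + 1 / 2 * fderiv ℝ fsForm x X v w

lemma fderiv_fsForm_symm (x b v w : Coord 4) :
    fderiv ℝ fsForm x b v w = fderiv ℝ fsForm x b w v := by
  rw [fderiv_fsForm_apply, fderiv_fsForm_apply, real_inner_comm v w]
  ring

/-- On the kernel of `dφ`, the Hessian is proportional to the metric. -/
lemma fsHessBilin_mul_fsForm {φ : Coord 4 → ℝ} {x X : Coord 4} (h : HessCondition fsForm φ x)
    (hφ : ContDiffAt ℝ 2 φ x) (hX : ∀ w, fsForm x X w = fderiv ℝ φ x w) (v w : Coord 4)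
    (hv : fderiv ℝ φ x v = 0) (hw : fderiv ℝ φ x w = 0) :
    fsHessBilin φ x X v w * fsForm x X X = -hessForm fsForm φ x X X * fsForm x v w := by
  have hdiag : ∀ v, fderiv ℝ φ x v = 0 →
      hessForm fsForm φ x v X * fsForm x X X = -hessForm fsForm φ x X X * fsForm x v v := by
    intro v hv
    by_cases hv0 : v = 0
    · simp [hv0, hessForm]
    by_cases hX0 : X = 0
    · simp [hX0, hessForm]
    have hvp := fsForm_pos x v hv0
    have hXp := fsForm_pos x X hX0
    -- The factor c rescales v to the length of X, as `HessCondition` requires.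
    set c := Real.sqrt (fsForm x X X / fsForm x v v)
    have hc : c * c = fsForm x X X / fsForm x v v := Real.mul_self_sqrt (by positivity)
    have h1 := h X hX (c • v) (by simp [hv]) (by
      simp only [map_smul, smul_apply, smul_eq_mul]
      rw [← mul_assoc, hc]
      field_simp)
    have h2 : hessForm fsForm φ x (c • v) X = c * c * hessForm fsForm φ x v X := by
      simp only [hessForm, map_smul, smul_apply, smul_eq_mul]
      ring
    rw [h2, hc] at h1
    field_simp at h1
    linarith
  have hsy : fderiv ℝ (fderiv ℝ φ) x v w = fderiv ℝ (fderiv ℝ φ) x w v :=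
    hφ.isSymmSndFDerivAt (by simp) v w
  -- Polarization: the diagonal identity for v + w, v and w gives the bilinear one.
  have hp : hessForm fsForm φ x (v + w) X = hessForm fsForm φ x v X + hessForm fsForm φ x w X +
      2 * fsHessBilin φ x X v w := by
    simp only [hessForm, fsHessBilin, map_add, add_apply]
    rw [hsy, fderiv_fsForm_symm x X v w]
    ring
  have h1 := hdiag (v + w) (by rw [map_add, hv, hw, add_zero])
  rw [hp] at h1
  have h2 := hdiag v hv
  have h3 := hdiag w hw
  simp only [map_add, add_apply, fsForm_symm x w v] at h1
  linear_combination (1 / 2) * h1 - (1 / 2) * h2 - (1 / 2) * h3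

/-- Eliminating the proportionality factor leaves an identity that can be differentiated with no
information on the derivative of Hess φ(X, X). -/
lemma fsHessBilin_cross {φ : Coord 4 → ℝ} {x X : Coord 4} (h : HessCondition fsForm φ x)
    (hφ : ContDiffAt ℝ 2 φ x) (hX0 : X ≠ 0) (hX : ∀ w, fsForm x X w = fderiv ℝ φ x w)
    (v w : Coord 4) (hv : fderiv ℝ φ x v = 0) (hw : fderiv ℝ φ x w = 0) :
    fsHessBilin φ x X v w * fsForm x v v - fsHessBilin φ x X v v * fsForm x v w = 0 := by
  have h1 := fsHessBilin_mul_fsForm h hφ hX v w hv hw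
  have h2 := fsHessBilin_mul_fsForm h hφ hX v v hv hv
  refine (mul_eq_zero.1 ?_).resolve_right (fsForm_pos x X hX0).ne'
  linear_combination fsForm x v v * h1 - fsForm x v w * h2

variable {φ : Coord 4 → ℝ}

/-- The Euclidean gradient. -/
lemma inner_gradient (x w : Coord 4) : inner ℝ (gradient φ x) w = fderiv ℝ φ x w := by
  simp [gradient]

lemma fsHessBilin_zero (X v w : Coord 4) :
    fsHessBilin φ 0 X v w = fderiv ℝ (fderiv ℝ φ) 0 v w := by
  simp [fsHessBilin, fderiv_fsForm_zero]

/-- At the centre the Hessian is the plain second derivative and the metric is Euclidean, so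
proportionality on ker dφ kills the entries on orthogonal pairs. -/
lemma fderiv_fderiv_eq_zero (h : HessCondition fsForm φ 0) (hφ : ContDiffAt ℝ 2 φ 0)
    (h0 : gradient φ 0 ≠ 0) {a b : Coord 4} (ha : fderiv ℝ φ 0 a = 0) (hb : fderiv ℝ φ 0 b = 0)
    (hab : inner ℝ a b = 0) : fderiv ℝ (fderiv ℝ φ) 0 a b = 0 := by
  have h1 := fsHessBilin_mul_fsForm h hφ (X := gradient φ 0)
    (fun w ↦ by rw [fsForm_zero, inner_gradient]) a b ha hb
  rw [fsForm_zero a b, hab, mul_zero, fsHessBilin_zero] at h1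
  exact (mul_eq_zero.1 h1).resolve_right (fsForm_pos 0 _ h0).ne'

/-- The derivative at the centre of the proportionality of the Hessian and the metric. -/
lemma third_derivative_eq (h : ∀ᶠ y in nhds 0, HessCondition fsForm φ y)
    (hφ : ContDiffAt ℝ 3 φ 0) (h0 : gradient φ 0 ≠ 0) {a b c : Coord 4} (ha : fderiv ℝ φ 0 a = 0)
    (hb : fderiv ℝ φ 0 b = 0) (hc : fderiv ℝ φ 0 c = 0) (hab : inner ℝ a b = 0)
    (hac : inner ℝ a c = 0) (hbc : inner ℝ b c = 0) (hb0 : b ≠ 0) :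
    fderiv ℝ (fderiv ℝ (fderiv ℝ φ)) 0 a b c =
      1 / 2 * fsHessian a b c (gradient φ 0) + 1 / 2 * fsHessian a c b (gradient φ 0) -
        1 / 2 * fsHessian a (gradient φ 0) b c := by
  have hφ2 : ContDiffAt ℝ 2 φ 0 := hφ.of_le (by norm_num)
  have hd1 : ContDiffAt ℝ 2 (fderiv ℝ φ) 0 := hφ.fderiv_right (by norm_num)
  have hl : HasDerivAt (fun t : ℝ ↦ t • a) a 0 := by
    simpa using (hasDerivAt_id (0 : ℝ)).smul_const a
  have hl0 : Filter.Tendsto (fun t : ℝ ↦ t • a) (nhds 0) (nhds 0) := by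
    simpa using hl.continuousAt.tendsto
  have hD1 : HasDerivAt (fun t : ℝ ↦ fderiv ℝ φ (t • a)) (fderiv ℝ (fderiv ℝ φ) 0 a) 0 := by
    have : HasFDerivAt (fderiv ℝ φ) (fderiv ℝ (fderiv ℝ φ) 0) ((0 : ℝ) • a) := by
      simpa using (hd1.differentiableAt (by norm_num)).hasFDerivAt
    exact HasFDerivAt.comp_hasDerivAt (l := fderiv ℝ φ) (0 : ℝ) this hl
  have hD2 : HasDerivAt (fun t : ℝ ↦ fderiv ℝ (fderiv ℝ φ) (t • a))
      (fderiv ℝ (fderiv ℝ (fderiv ℝ φ)) 0 a) 0 := by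
    have : HasFDerivAt (fderiv ℝ (fderiv ℝ φ)) (fderiv ℝ (fderiv ℝ (fderiv ℝ φ)) 0)
        ((0 : ℝ) • a) := by
      simpa using hd1.differentiableAt_fderiv.hasFDerivAt
    exact HasFDerivAt.comp_hasDerivAt (l := fderiv ℝ (fderiv ℝ φ)) (0 : ℝ) this hl
  have hB : HasDerivAt (fun t : ℝ ↦ fsForm (t • a)) 0 0 := by
    have : HasFDerivAt fsForm (0 : Coord 4 →L[ℝ] Coord 4 →L[ℝ] Coord 4 →L[ℝ] ℝ) ((0 : ℝ) • a) := by
      rw [zero_smul, ← fderiv_fsForm_zero]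
      exact (contDiff_fsForm.differentiable (by simp) 0).hasFDerivAt
    exact HasFDerivAt.comp_hasDerivAt (l := fsForm) (0 : ℝ) this hl
  set N := gradient φ 0 with hN
  have hN0 : fderiv ℝ φ 0 N ≠ 0 := by
    rw [← inner_gradient]
    exact (real_inner_self_pos.2 h0).ne'
  set X : ℝ → Coord 4 := fun t ↦ fsGradient (t • a) (gradient φ (t • a)) with hXdef
  have hX0 : X 0 = N := by simp [hXdef, fsGradient, hN]
  have hg : ContinuousAt (fun t : ℝ ↦ gradient φ (t • a)) 0 :=
    (InnerProductSpace.toDual ℝ (Coord 4)).symm.continuous.continuousAt.comp hD1.continuousAt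
  have hXc : ContinuousAt X 0 := by
    simp only [hXdef, fsGradient]
    fun_prop
  -- V z t is z projected along N into the kernel of dφ at t • a. Its derivative at t = 0 is a
  -- multiple of φ''(a, z)N, which vanishes by `fderiv_fderiv_eq_zero`; the moving arguments
  -- therefore contribute nothing to first order.
  let V : Coord 4 → ℝ → Coord 4 := fun z t ↦ z - (fderiv ℝ φ (t • a) z / fderiv ℝ φ (t • a) N) • N
  have hV0 : ∀ z, fderiv ℝ φ 0 z = 0 → V z 0 = z := fun z hz ↦ by simp [V, hz]
  have hV : ∀ z, fderiv ℝ φ 0 z = 0 → inner ℝ a z = 0 → HasDerivAt (V z) 0 0 := by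
    intro z hz haz
    have h1 := hD1.clm_apply (hasDerivAt_const (0 : ℝ) z)
    have h2 := hD1.clm_apply (hasDerivAt_const (0 : ℝ) N)
    have h3 := ((h1.div h2 (by simpa using hN0)).smul_const N).const_sub z
    refine h3.congr_deriv ?_
    simp [hz, fderiv_fderiv_eq_zero h.self_of_nhds hφ2 h0 ha hz haz]
  have hVb := hV b hb hab
  have hVc := hV c hc hac
  have key : ∀ u w, fderiv ℝ φ 0 u = 0 → fderiv ℝ φ 0 w = 0 → inner ℝ a u = 0 → inner ℝ a w = 0 →
      HasDerivAt (fun t ↦ fsHessBilin φ (t • a) (X t) (V u t) (V w t))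
        (fderiv ℝ (fderiv ℝ (fderiv ℝ φ)) 0 a u w - 1 / 2 * fsHessian a u w N -
          1 / 2 * fsHessian a w u N + 1 / 2 * fsHessian a N u w) 0 ∧
      HasDerivAt (fun t ↦ fsForm (t • a) (V u t) (V w t)) 0 0 := by
    intro u w hu hw hau haw
    have hVu := hV u hu hau
    have hVw := hV w hw haw
    refine ⟨?_, ?_⟩
    · have h1 := (hD2.clm_apply hVu).clm_apply hVw
      have h2 := hasDerivAt_fderiv_fsForm a hVu.continuousAt hVw.continuousAt hXc
      have h3 := hasDerivAt_fderiv_fsForm a hVw.continuousAt hVu.continuousAt hXc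
      have h4 := hasDerivAt_fderiv_fsForm a hXc hVu.continuousAt hVw.continuousAt
      have h5 := ((h1.sub (h2.const_mul (1 / 2))).sub (h3.const_mul (1 / 2))).add
        (h4.const_mul (1 / 2))
      refine h5.congr_deriv ?_
      simp [hV0 u hu, hV0 w hw, hX0]
    · refine ((hB.clm_apply hVu).clm_apply hVw).congr_deriv ?_
      simp
  obtain ⟨kbc, gbc⟩ := key b c hb hc hab hac
  obtain ⟨kbb, gbb⟩ := key b b hb hb hab hab
  have hprod := (kbc.mul gbb).sub (kbb.mul gbc)
  have hzero : (fun t ↦ fsHessBilin φ (t • a) (X t) (V b t) (V c t) *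
      fsForm (t • a) (V b t) (V b t) - fsHessBilin φ (t • a) (X t) (V b t) (V b t) *
      fsForm (t • a) (V b t) (V c t)) =ᶠ[nhds 0] fun _ ↦ 0 := by
    have e1 : ∀ᶠ t : ℝ in nhds 0, fderiv ℝ φ (t • a) N ≠ 0 :=
      (hD1.clm_apply (hasDerivAt_const (0 : ℝ) N)).continuousAt.eventually_ne (by simpa using hN0)
    have e2 : ∀ᶠ t : ℝ in nhds 0, X t ≠ 0 := hXc.eventually_ne (by rwa [hX0])
    filter_upwards [hl0.eventually h, hl0.eventually (hφ2.eventually (by simp)), e1, e2]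
      with t h1 h2 h3 h4
    have hk : ∀ z, fderiv ℝ φ (t • a) (V z t) = 0 := fun z ↦ by
      simp only [V, map_sub, map_smul, smul_eq_mul]
      field_simp
      simp
    exact fsHessBilin_cross h1 h2 h4 (fun w ↦ by rw [fsForm_fsGradient, inner_gradient]) _ _ (hk b)
      (hk c)
  -- The derivative of the metric along the curve is 0, and ⟨b, c⟩ = 0 removes the unknown
  -- derivative of the Hessian at (b, b). What survives is the derivative of the Hessian at (b, c)
  -- times ⟨b, b⟩.
  have hfin := hprod.unique ((hasDerivAt_const (0 : ℝ) (0 : ℝ)).congr_of_eventuallyEq hzero)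
  simp only [zero_smul, hV0 b hb, hV0 c hc, hX0, fsForm_zero, hbc, mul_zero, add_zero,
    sub_zero] at hfin
  have hbb : inner ℝ b b ≠ 0 := (real_inner_self_pos.2 hb0).ne'
  have := (mul_eq_zero.1 hfin).resolve_right hbb
  linarith

/-- No function near the centre of an affine chart satisfies the condition on the Hessian of a
limiting Carleman weight. -/
lemma not_eventually_hessCondition (hφ : ContDiffAt ℝ 3 φ 0) (h0 : gradient φ 0 ≠ 0) :
    ¬ ∀ᶠ y in nhds 0, HessCondition fsForm φ y := by
  intro h
  set N := gradient φ 0 with hN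
  obtain ⟨q1, q2, q3⟩ := inner_quaternionic_self N
  set y := quaternionic N
  have q4 : inner ℝ N (complexStructure y) = 0 := by
    rw [← neg_eq_zero, ← inner_complexStructure_left, q2]
  have q5 := inner_complexStructure_self N
  have q6 := inner_complexStructure_self y
  have q7 : inner ℝ (complexStructure N) (complexStructure y) = 0 := by
    rw [inner_complexStructure_complexStructure, q1]
  have hpos : 0 < inner ℝ N N := real_inner_self_pos.2 h0
  have n1 : fderiv ℝ φ 0 (complexStructure N) = 0 := by
    rw [← inner_gradient, real_inner_comm, q5]
  have n2 : fderiv ℝ φ 0 y = 0 := by rw [← inner_gradient, ← hN, q1]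
  have n3 : fderiv ℝ φ 0 (complexStructure y) = 0 := by rw [← inner_gradient, ← hN, q4]
  have hy0 : y ≠ 0 := fun hy ↦ by
    rw [← q3, hy, inner_zero_left] at hpos
    exact hpos.false
  have hJ0 : complexStructure N ≠ 0 := fun hy ↦ by
    rw [← inner_complexStructure_complexStructure, hy, inner_zero_left] at hpos
    exact hpos.false
  have q6' : inner ℝ y (complexStructure y) = 0 := by rw [real_inner_comm, q6]
  have q2' : inner ℝ y (complexStructure N) = 0 := by rw [real_inner_comm, q2]
  -- The vectors N, JN, y, Jy are pairwise orthogonal, yet R(JN, y, Jy, N) = |N|⁴. The two formulas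
  -- compute the same third derivative with JN and y interchanged: the first evaluates to 0, the
  -- second to |N|⁴.
  have t1 := third_derivative_eq h hφ h0 n1 n2 n3 q2 q7 q6' hy0
  have t2 := third_derivative_eq h hφ h0 n2 n1 n3 q2' q6' q7 hJ0
  have hd1 : ContDiffAt ℝ 2 (fderiv ℝ φ) 0 := hφ.fderiv_right (by norm_num)
  have hs : fderiv ℝ (fderiv ℝ (fderiv ℝ φ)) 0 (complexStructure N) y =
      fderiv ℝ (fderiv ℝ (fderiv ℝ φ)) 0 y (complexStructure N) :=
    hd1.isSymmSndFDerivAt (by simp) _ _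
  rw [hs, t2] at t1
  have q1' : inner ℝ y N = 0 := by rw [real_inner_comm, q1]
  have q5' : inner ℝ N (complexStructure N) = 0 := by rw [real_inner_comm, q5]
  have q4' : inner ℝ (complexStructure y) N = 0 := by rw [real_inner_comm, q4]
  have q7' : inner ℝ (complexStructure y) (complexStructure N) = 0 := by rw [real_inner_comm, q7]
  simp only [fsHessian, complexStructure_complexStructure, inner_neg_left,
    inner_complexStructure_complexStructure, ← hN, q1, q2, q3, q4, q5, q6, q7, q1', q2', q4', q5',
    q6', q7', mul_zero, add_zero, zero_add, neg_zero, sub_zero] at t1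
  nlinarith [mul_pos hpos hpos]

end CP2

/-! ### Transfer through local isometries. -/

section Isometry

variable {M : Type*} [TopologicalSpace M] [ChartedSpace (Coord 4) M]

/-- The points F₁ z and F₂ z are equal only propositionally, so the tangent vectors have different
types; they are compared as elements of the common model space. -/
lemma inner_mfderiv_congr {n : ℕ} {N : Type*} [TopologicalSpace N] [ChartedSpace (Coord n) N]
    [IsManifold (𝓡 n) ∞ N] (h : SmoothMetric n N) {F₁ F₂ : Coord n → N} {z : Coord n}
    (hF : F₁ =ᶠ[nhds z] F₂) (v w : Coord n) :
    h.inner (F₁ z) (mfderiv (𝓡 n) (𝓡 n) F₁ z v) (mfderiv (𝓡 n) (𝓡 n) F₁ z w) =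
      h.inner (F₂ z) (mfderiv (𝓡 n) (𝓡 n) F₂ z v) (mfderiv (𝓡 n) (𝓡 n) F₂ z w) := by
  have key : ∀ (a b : N) (_ : a = b) (v w : Coord n),
      h.inner a (v : TangentSpace (𝓡 n) a) (w : TangentSpace (𝓡 n) a) =
        h.inner b (v : TangentSpace (𝓡 n) b) (w : TangentSpace (𝓡 n) b) := by
    rintro a _ rfl v w
    rfl
  have hm : ∀ v : Coord n, (mfderiv (𝓡 n) (𝓡 n) F₁ z v : Coord n) =
      (mfderiv (𝓡 n) (𝓡 n) F₂ z v : Coord n) := fun v ↦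
    DFunLike.congr_fun (hF.mfderiv_eq (I := 𝓡 n) (I' := 𝓡 n)) v
  refine (key _ _ hF.self_of_nhds _ _).trans ?_
  have hv := hm v
  have hw := hm w
  exact congr (congrArg (fun a b : Coord n ↦ h.inner (F₂ z) (a : TangentSpace (𝓡 n) (F₂ z))
    (b : TangentSpace (𝓡 n) (F₂ z))) hv) hw

open CP2

/-- A local isometry into `CP²`, read in the preferred chart at `p` and an affine chart. -/
noncomputable def isometryInCharts (f : OpenPartialHomeomorph M CP2) (u : Frame) (p : M)
    (x : Coord 4) : Coord 4 :=
  chart u (f ((extChartAt (𝓡 4) p).symm x))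

/-- The points of the chart where `isometryInCharts` is defined. -/
def isometryDomain (f : OpenPartialHomeomorph M CP2) (u : Frame) (p : M) : Set (Coord 4) :=
  {x | x ∈ (extChartAt (𝓡 4) p).target ∧ (extChartAt (𝓡 4) p).symm x ∈ f.source ∧
    f ((extChartAt (𝓡 4) p).symm x) ∈ (chart u).source}

lemma isOpen_isometryDomain {f : OpenPartialHomeomorph M CP2} {u : Frame} {p : M} :
    IsOpen (isometryDomain f u p) := by
  have h1 : IsOpen (f.source ∩ f ⁻¹' (chart u).source) :=
    f.isOpen_inter_preimage (chart u).open_source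
  exact (continuousOn_extChartAt_symm p).isOpen_inter_preimage (isOpen_extChartAt_target p) h1

variable [IsManifold (𝓡 4) ∞ M]

lemma contMDiffAt_chart {u : Frame} {q : CP2} (hq : q ∈ (chart u).source) :
    ContMDiffAt (𝓡 4) (𝓡 4) ∞ (chart u) q :=
  (contMDiffOn_of_mem_maximalAtlas (I := 𝓡 4) (n := ∞) (IsManifold.subset_maximalAtlas
    (show chart u ∈ atlas (Coord 4) CP2 from ⟨u, rfl⟩))).contMDiffAt
    ((chart u).open_source.mem_nhds hq)

lemma contMDiffAt_chart_symm (u : Frame) (x : Coord 4) :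
    ContMDiffAt (𝓡 4) (𝓡 4) ∞ (chart u).symm x :=
  (contMDiffOn_symm_of_mem_maximalAtlas (I := 𝓡 4) (n := ∞) (IsManifold.subset_maximalAtlas
    (show chart u ∈ atlas (Coord 4) CP2 from ⟨u, rfl⟩))).contMDiffAt (by simp [chart])

variable {g : SmoothMetric 4 M} {f : OpenPartialHomeomorph M CP2} {u : Frame} {p : M}

lemma contMDiffAt_extChartAt_symm {x : Coord 4} (hx : x ∈ (extChartAt (𝓡 4) p).target) :
    ContMDiffAt (𝓡 4) (𝓡 4) ∞ (extChartAt (𝓡 4) p).symm x :=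
  (contMDiffOn_extChartAt_symm p).contMDiffAt ((isOpen_extChartAt_target p).mem_nhds hx)

lemma contMDiffAt_comp_extChartAt_symm (hf : ContMDiffOn (𝓡 4) (𝓡 4) ∞ f f.source) {x : Coord 4}
    (hx : x ∈ isometryDomain f u p) :
    ContMDiffAt (𝓡 4) (𝓡 4) ∞ (fun x ↦ f ((extChartAt (𝓡 4) p).symm x)) x :=
  (hf.contMDiffAt (f.open_source.mem_nhds hx.2.1)).comp x (contMDiffAt_extChartAt_symm hx.1)

lemma contDiffAt_isometryInCharts (hf : ContMDiffOn (𝓡 4) (𝓡 4) ∞ f f.source) {x : Coord 4}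
    (hx : x ∈ isometryDomain f u p) : ContDiffAt ℝ ∞ (isometryInCharts f u p) x :=
  contMDiffAt_iff_contDiffAt.1
    ((contMDiffAt_chart hx.2.2).comp x (contMDiffAt_comp_extChartAt_symm hf hx))

/-- Near x the map f ∘ κ, with κ the inverse chart of M, is the inverse affine chart after
`isometryInCharts`. The chain rule on both sides, the isometry property and the form of the metric
in affine charts give the claim. -/
lemma metricInChart_eq_pullback (hf : ContMDiffOn (𝓡 4) (𝓡 4) ∞ f f.source)
    (hiso : ∀ q ∈ f.source, ∀ v w : TangentSpace (𝓡 4) q,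
      fubiniStudy.inner (f q) (mfderiv (𝓡 4) (𝓡 4) f q v) (mfderiv (𝓡 4) (𝓡 4) f q w) =
        g.inner q v w) {x : Coord 4} (hx : x ∈ isometryDomain f u p) :
    metricInChart g p x = Matrix.of fun i j ↦ pullbackForm fsForm (isometryInCharts f u p) x
      (EuclideanSpace.single i 1) (EuclideanSpace.single j 1) := by
  ext i j
  rw [metricInChart, Matrix.of_apply, Matrix.of_apply, pullbackForm_apply]
  set κ := (extChartAt (𝓡 4) p).symm
  have hκ : MDifferentiableAt (𝓡 4) (𝓡 4) κ x :=
    (contMDiffAt_extChartAt_symm hx.1).mdifferentiableAt (by simp)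
  have hfd : MDifferentiableAt (𝓡 4) (𝓡 4) f (κ x) :=
    (hf.contMDiffAt (f.open_source.mem_nhds hx.2.1)).mdifferentiableAt (by simp)
  have hΨ : DifferentiableAt ℝ (isometryInCharts f u p) x :=
    (contDiffAt_isometryInCharts hf hx).differentiableAt (by simp)
  have hc : MDifferentiableAt (𝓡 4) (𝓡 4) (chart u).symm (isometryInCharts f u p x) :=
    (contMDiffAt_chart_symm u _).mdifferentiableAt (by simp)
  have e1 : ∀ v : Coord 4, mfderiv (𝓡 4) (𝓡 4) (f ∘ κ) x v =
      mfderiv (𝓡 4) (𝓡 4) f (κ x) (mfderiv (𝓡 4) (𝓡 4) κ x v) := fun v ↦ by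
    rw [mfderiv_comp x hfd hκ]
    rfl
  have e2 : ∀ v : Coord 4,
      mfderiv (𝓡 4) (𝓡 4) ((chart u).symm ∘ isometryInCharts f u p) x v =
      mfderiv (𝓡 4) (𝓡 4) (chart u).symm (isometryInCharts f u p x)
        (fderiv ℝ (isometryInCharts f u p) x v) := fun v ↦ by
    rw [mfderiv_comp x hc hΨ.mdifferentiableAt, mfderiv_eq_fderiv]
    rfl
  have hev : f ∘ κ =ᶠ[nhds x] (chart u).symm ∘ isometryInCharts f u p := by
    filter_upwards [isOpen_isometryDomain.mem_nhds hx] with z hz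
    exact ((chart u).left_inv hz.2.2).symm
  have e3 := inner_mfderiv_congr fubiniStudy hev (EuclideanSpace.single i 1)
    (EuclideanSpace.single j 1)
  refine ((hiso (κ x) hx.2.1 _ _).symm.trans ?_).trans
    (fubiniStudy_inner_mfderiv_chart_symm u (isometryInCharts f u p x) _ _)
  rw [e1, e1, e2, e2] at e3
  exact e3

/-- A limiting Carleman weight, read in an affine chart of `CP²` through a local isometry, satisfies
the condition on the Hessian. -/
lemma hessCondition_of_isLimitingCarlemanWeightOn
    (hf : ContMDiffOn (𝓡 4) (𝓡 4) ∞ f f.source) (hf' : ContMDiffOn (𝓡 4) (𝓡 4) ∞ f.symm f.target)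
    (hiso : ∀ q ∈ f.source, ∀ v w : TangentSpace (𝓡 4) q,
      fubiniStudy.inner (f q) (mfderiv (𝓡 4) (𝓡 4) f q v) (mfderiv (𝓡 4) (𝓡 4) f q w) =
        g.inner q v w) {U : Set M} (hU : IsOpen U) {φ : M → ℝ}
    (hφ : IsLimitingCarlemanWeightOn g U φ) {y : Coord 4} (hy : (chart u).symm y ∈ f.target)
    (hyU : f.symm ((chart u).symm y) ∈ U) :
    ContDiffAt ℝ ∞ (fun z ↦ φ (f.symm ((chart u).symm z))) y ∧
      HessCondition fsForm (fun z ↦ φ (f.symm ((chart u).symm z))) y := by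
  have hφs : ∀ p ∈ U, ContMDiffAt (𝓡 4) 𝓘(ℝ) ∞ φ p := fun p hp ↦
    hφ.1.contMDiffAt (hU.mem_nhds hp)
  have hfc : ContMDiffAt (𝓡 4) (𝓡 4) ∞ (fun z ↦ f.symm ((chart u).symm z)) y :=
    (hf'.contMDiffAt (f.open_target.mem_nhds hy)).comp y (contMDiffAt_chart_symm u y)
  have hψ : ContDiffAt ℝ ∞ (fun z ↦ φ (f.symm ((chart u).symm z))) y :=
    contMDiffAt_iff_contDiffAt.1 ((hφs _ hyU).comp y hfc)
  refine ⟨hψ, ?_⟩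
  set p := f.symm ((chart u).symm y) with hp
  set x := extChartAt (𝓡 4) p p with hx
  set Ψ := isometryInCharts f u p with hΨdef
  have hpf : p ∈ f.source := f.map_target hy
  have hfp : f p = (chart u).symm y := f.right_inv hy
  have hκx : (extChartAt (𝓡 4) p).symm x = p := extChartAt_to_inv p
  have hyt : y ∈ (chart u).target := trivial
  have hxd : x ∈ isometryDomain f u p := by
    refine ⟨mem_extChartAt_target p, ?_, ?_⟩
    · rwa [hκx]
    · rw [hκx, hfp]
      exact (chart u).map_target hyt
  have hΨx : Ψ x = y := by
    change chart u (f ((extChartAt (𝓡 4) p).symm x)) = y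
    rw [hκx, hfp]
    exact (chart u).right_inv hyt
  have hΨ := contDiffAt_isometryInCharts hf hxd
  have hΨ2 : ContDiffAt ℝ 2 Ψ x := contDiffAt_infty.1 hΨ 2
  -- The map Φ, built from the smooth inverse of f, satisfies Ψ ∘ Φ = id near y, so dΨ has a right
  -- inverse. Equality of dimensions then yields injectivity, needed for positivity of the
  -- pulled-back form.
  have hsurj : Function.Surjective (fderiv ℝ Ψ x) := by
    let Φ : Coord 4 → Coord 4 := fun z ↦ extChartAt (𝓡 4) p (f.symm ((chart u).symm z))
    have hΦ : DifferentiableAt ℝ Φ y :=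
      (contMDiffAt_iff_contDiffAt.1 ((contMDiffAt_extChartAt (I := 𝓡 4) (n := ∞) (x := p)).comp y
        hfc)).differentiableAt (by simp)
    have hΦy : Φ y = x := rfl
    have hid : Ψ ∘ Φ =ᶠ[nhds y] id := by
      have h1 : ∀ᶠ z in nhds y, f.symm ((chart u).symm z) ∈ (extChartAt (𝓡 4) p).source :=
        hfc.continuousAt.eventually_mem (extChartAt_source_mem_nhds (I := 𝓡 4) p)
      have h2 : ∀ᶠ z in nhds y, (chart u).symm z ∈ f.target :=
        (contMDiffAt_chart_symm u y).continuousAt.eventually_mem (f.open_target.mem_nhds hy)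
      filter_upwards [h1, h2] with z hz1 hz2
      change chart u (f ((extChartAt (𝓡 4) p).symm (extChartAt (𝓡 4) p _))) = z
      rw [(extChartAt (𝓡 4) p).left_inv hz1, f.right_inv hz2]
      exact (chart u).right_inv trivial
    have h3 := hid.fderiv_eq (𝕜 := ℝ)
    rw [fderiv_comp y (by rw [hΦy]; exact hΨ.differentiableAt (by simp)) hΦ, hΦy, fderiv_id] at h3
    exact fun w ↦ ⟨fderiv ℝ Φ y w, DFunLike.congr_fun h3 w⟩
  have hinj : Function.Injective (fderiv ℝ Ψ x) :=
    (LinearMap.injective_iff_surjective (f := (fderiv ℝ Ψ x).toLinearMap)).2 hsurj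
  have hB : ∀ z, DifferentiableAt ℝ fsForm z := contDiff_fsForm.differentiable (by simp)
  have hφκ : ContDiffAt ℝ ∞ (φ ∘ (extChartAt (𝓡 4) p).symm) x := by
    have h1 : ContMDiffAt (𝓡 4) 𝓘(ℝ) ∞ φ ((extChartAt (𝓡 4) p).symm x) := by
      rw [hκx]
      exact hφs p hyU
    exact contMDiffAt_iff_contDiffAt.1 (h1.comp x (contMDiffAt_extChartAt_symm hxd.1))
  have hcond : HessCondition (pullbackForm fsForm Ψ) (φ ∘ (extChartAt (𝓡 4) p).symm) x := by
    refine hessCondition_of_poissonBracket (G := metricInChart g p) ?_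
      (differentiableAt_pullbackForm hΨ2 (hB _)) (fun v w ↦ ?_) (fun v hv ↦ ?_)
      (contDiffAt_infty.1 hφκ 2) (hφ.2 p hyU).2
    · filter_upwards [isOpen_isometryDomain.mem_nhds hxd] with z hz
      exact metricInChart_eq_pullback hf hiso hz
    · rw [pullbackForm_apply, pullbackForm_apply, fsForm_symm]
    · rw [pullbackForm_apply]
      exact fsForm_pos _ _ fun h0 ↦ hv (hinj (h0.trans (map_zero _).symm))
  have hev : φ ∘ (extChartAt (𝓡 4) p).symm =ᶠ[nhds x]
      (fun z ↦ φ (f.symm ((chart u).symm z))) ∘ Ψ := by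
    filter_upwards [isOpen_isometryDomain.mem_nhds hxd] with z hz
    change φ _ = φ (f.symm ((chart u).symm (chart u _)))
    rw [(chart u).left_inv hz.2.2, f.left_inv hz.2.1]
  rw [← hΨx] at hψ ⊢
  exact hessCondition_of_pullback hΨ2 hsurj (hB _) (fun v w ↦ fsForm_symm _ _ _)
    (contDiffAt_infty.1 hψ 2) (hcond.congr hev)

/-- A manifold locally isometric to `CP²` has no limiting Carleman weights. -/
theorem not_exists_isLimitingCarlemanWeightOn (hg : IsLocallyIsometricTo g fubiniStudy) {U : Set M}
    (hU : IsOpen U) (hne : U.Nonempty) : ¬ ∃ φ : M → ℝ, IsLimitingCarlemanWeightOn g U φ := by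
  rintro ⟨φ, hφ⟩
  obtain ⟨p, hpU⟩ := hne
  obtain ⟨f, hpf, hf, hf', hiso⟩ := hg p
  set u := frameAt (f p)
  have hc0 : chart u (f p) = 0 := chartAt_self (f p)
  have hsrc : f p ∈ (chart u).source := mem_chart_source (Coord 4) (f p)
  have hc0' : (chart u).symm 0 = f p := by rw [← hc0, (chart u).left_inv hsrc]
  -- The weight is read in the affine chart centred at f p, so that `not_eventually_hessCondition`
  -- applies at 0.
  set ψ : Coord 4 → ℝ := fun z ↦ φ (f.symm ((chart u).symm z)) with hψdef
  have h1 : ∀ᶠ y in nhds (0 : Coord 4), (chart u).symm y ∈ f.target := by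
    refine (contMDiffAt_chart_symm u 0).continuousAt.eventually_mem (f.open_target.mem_nhds ?_)
    rw [hc0']
    exact f.map_source hpf
  have hft : (chart u).symm 0 ∈ f.target := h1.self_of_nhds
  have h2 : ∀ᶠ y in nhds (0 : Coord 4), f.symm ((chart u).symm y) ∈ U := by
    have h3 : ContinuousAt (fun y ↦ f.symm ((chart u).symm y)) 0 :=
      (f.symm.continuousAt hft).comp (contMDiffAt_chart_symm u 0).continuousAt
    refine h3.eventually_mem (hU.mem_nhds ?_)
    rw [hc0', f.left_inv hpf]
    exact hpU
  have hψ := (hessCondition_of_isLimitingCarlemanWeightOn hf hf' hiso hU hφ hft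
    h2.self_of_nhds).1
  refine not_eventually_hessCondition (φ := ψ) (contDiffAt_infty.1 hψ 3) ?_ ?_
  -- Near p the weight is ψ composed with the affine chart and f, so a zero gradient of ψ at 0 would
  -- make dφ vanish at p.
  · intro hgrad
    have hd0 : fderiv ℝ ψ 0 = 0 := by
      ext w
      rw [← inner_gradient, hgrad, inner_zero_left]
      rfl
    refine (hφ.2 p hpU).1 ?_
    have hcf : ContMDiffAt (𝓡 4) (𝓡 4) ∞ (fun q ↦ chart u (f q)) p :=
      (contMDiffAt_chart hsrc).comp p (hf.contMDiffAt (f.open_source.mem_nhds hpf))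
    have hev : φ =ᶠ[nhds p] ψ ∘ fun q ↦ chart u (f q) := by
      filter_upwards [f.open_source.mem_nhds hpf,
        (f.continuousAt hpf).eventually_mem ((chart u).open_source.mem_nhds hsrc)] with q hq hq'
      change φ q = φ (f.symm ((chart u).symm (chart u (f q))))
      rw [(chart u).left_inv hq', f.left_inv hq]
    have hψd : MDifferentiableAt (𝓡 4) 𝓘(ℝ) ψ (chart u (f p)) := by
      rw [hc0]
      exact (hψ.differentiableAt (by simp)).mdifferentiableAt
    rw [hev.mfderiv_eq, mfderiv_comp p hψd (hcf.mdifferentiableAt (by simp)), mfderiv_eq_fderiv]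
    ext w
    have : fderiv ℝ ψ (chart u (f p)) = 0 := by rw [hc0, hd0]
    exact DFunLike.congr_fun this _
  · filter_upwards [h1, h2] with y hy hy'
    exact (hessCondition_of_isLimitingCarlemanWeightOn hf hf' hiso hU hφ hy hy').2

end Isometry

/-! ### The projective plane as its own local model, and the four assertions. -/

lemma CP2.isLocallyIsometricTo_self :
    IsLocallyIsometricTo CP2.fubiniStudy CP2.fubiniStudy := by
  intro p
  refine ⟨OpenPartialHomeomorph.refl CP2, trivial, contMDiff_id.contMDiffOn,
    contMDiff_id.contMDiffOn, fun q _ v w ↦ ?_⟩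
  have h := mfderiv_id (I := 𝓡 4) (x := q)
  have hv : ∀ v : TangentSpace (𝓡 4) q,
      mfderiv (𝓡 4) (𝓡 4) (OpenPartialHomeomorph.refl CP2) q v = v := fun v ↦
    DFunLike.congr_fun h v
  rw [hv, hv]
  rfl

theorem mainTheorem8 :
    -- the Weyl operator, in every basis of the form `e₁, J e₁, e₃, J e₃`
    (∀ p : CP2, (∃ e : Fin 4 → TangentSpace (𝓡 4) p, CP2.IsAdaptedFrame p e) ∧
      ∀ e : Fin 4 → TangentSpace (𝓡 4) p, CP2.IsAdaptedFrame p e →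
        IsCompl (hodgeEigenspace CP2.fubiniStudy p e 1)
          (hodgeEigenspace CP2.fubiniStudy p e (-1)) ∧
        (∃ (b : Module.Basis (Fin 3) ℝ (hodgeEigenspace CP2.fubiniStudy p e 1))
          (h : ∀ σ ∈ hodgeEigenspace CP2.fubiniStudy p e 1,
            weylOperator CP2.fubiniStudy p σ ∈ hodgeEigenspace CP2.fubiniStudy p e 1),
          (∀ i, (b i : Bivector 4 p) = selfDualFrame e i) ∧
          LinearMap.toMatrix b b ((weylOperator CP2.fubiniStudy p).restrict h) =
            Matrix.diagonal ![4, -2, -2]) ∧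
        ∀ σ ∈ hodgeEigenspace CP2.fubiniStudy p e (-1), weylOperator CP2.fubiniStudy p σ = 0) ∧
    -- the eigenflag condition fails at every point
    (∀ p : CP2, ¬ Eigenflag CP2.fubiniStudy p (weylOperator CP2.fubiniStudy p)) ∧
    -- no domain in the projective plane admits a limiting Carleman weight
    (∀ U : Set CP2, IsOpen U → U.Nonempty →
      ¬ ∃ φ : CP2 → ℝ, IsLimitingCarlemanWeightOn CP2.fubiniStudy U φ) ∧
    -- nor does any domain in a manifold locally isometric to it
    (∀ (M : Type*) [TopologicalSpace M] [ChartedSpace (Coord 4) M] [IsManifold (𝓡 4) ∞ M]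
      (g : SmoothMetric 4 M), IsLocallyIsometricTo g CP2.fubiniStudy →
      ∀ U : Set M, IsOpen U → U.Nonempty →
        ¬ ∃ φ : M → ℝ, IsLimitingCarlemanWeightOn g U φ) := by
  refine ⟨fun p ↦ ⟨?_, fun e he ↦ ?_⟩, CP2.not_eigenflag, fun U hU hne ↦
    not_exists_isLimitingCarlemanWeightOn CP2.isLocallyIsometricTo_self hU hne,
    fun M _ _ _ g hg U hU hne ↦ not_exists_isLimitingCarlemanWeightOn hg hU hne⟩
  · obtain ⟨v, hv⟩ := CP2.exists_unit p
    obtain ⟨e, he, -⟩ := CP2.exists_isAdaptedFrame v hv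
    exact ⟨e, he⟩
  refine ⟨isCompl_hodgeEigenspace he.1, ?_, fun σ hσ ↦ ?_⟩
  · obtain ⟨b, hb⟩ := exists_basis_hodgeEigenspace_one he.1
    have h : ∀ σ ∈ hodgeEigenspace CP2.fubiniStudy p e 1,
        weylOperator CP2.fubiniStudy p σ ∈ hodgeEigenspace CP2.fubiniStudy p e 1 := by
      intro σ hσ
      rw [eq_sum_of_mem_hodgeEigenspace_one he.1 hσ, map_sum]
      refine Submodule.sum_mem _ fun i _ ↦ ?_
      rw [map_smul, (he.weylOperator_frame i).1]
      exact Submodule.smul_mem _ _ (Submodule.smul_mem _ _ (frame_mem_hodgeEigenspace he.1 i).1)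
    refine ⟨b, h, hb, ?_⟩
    ext i j
    have hj : (weylOperator CP2.fubiniStudy p).restrict h (b j) =
        (![4, -2, -2] : Fin 3 → ℝ) j • b j := by
      apply Subtype.ext
      rw [LinearMap.coe_restrict_apply, hb, (he.weylOperator_frame j).1, Submodule.coe_smul, hb]
    rw [LinearMap.toMatrix_apply, hj, map_smul, Module.Basis.repr_self, Finsupp.smul_apply,
      Finsupp.single_apply, Matrix.diagonal_apply]
    by_cases hij : i = j
    · simp [hij]
    · simp [hij, Ne.symm hij]
  · rw [eq_sum_of_mem_hodgeEigenspace_neg_one he.1 hσ, map_sum]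
    refine Finset.sum_eq_zero fun i _ ↦ ?_
    rw [map_smul, (he.weylOperator_frame i).2, smul_zero]
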